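/- Let $(\mathcal M,g)$ be a nonempty compact smooth Riemannian manifold without boundary, of dimension $m\ge 1$, and let $(\mathcal N,h)$ be a smooth Riemannian manifold without boundary. Let $\phi:\mathcal M\to\mathcal N$ and $f:\mathcal M\to\mathbb R$ be smooth, and let $\alpha\ge 0$ and $\lambda>0$ be real constants such that $((\mathcal M,g),(\mathcal N,h),\phi,f,\lambda)$ is a (shrinking) Ricci-harmonic soliton, that is, $$\operatorname{Ric}_g-\alpha\,\phi^*h+\operatorname{Hess} f=\lambda g,\qquad \tau_g\phi=\langle\nabla\phi,\nabla f\rangle := d\phi(\nabla f),$$ where $\tau_g\phi=\operatorname{trace}_g\nabla d\phi$ is the tension field of $\phi$. Let $S=R-\alpha|\nabla\phi|^2$ be the generalized scalar curvature, where $R$ is the scalar curvature of $g$ and $|\nabla\phi|^2=\operatorname{trace}_g(\phi^*h)$. Then $S$ attains a maximum $S_{\max}$ on $\mathcal M$, and the soliton is harmonic-Einstein, that is, $$\operatorname{Ric}_g-\alpha\,\phi^*h=\lambda g,\qquad \tau_g\phi=0,$$ if and only if $$S_{\max}-m\lambda\le\left(1+\frac2m\right)\frac1{\operatorname{vol}(\mathcal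 M,g)}\int_{\mathcal M}\|\nabla f\|^2 .$$ Here the volume and the integral are taken with respect to the Riemannian volume measure of $g$. -/

import Mathlib

open MeasureTheory Bundle
open scoped Manifold ContDiff

noncomputable section

namespace RicciHarmonic

/-! ### Local coordinate expressions on `ℝᵐ` -/

/-- The coordinate space `ℝᵐ`. -/
abbrev Coord (m : ℕ) : Type := EuclideanSpace ℝ (Fin m)

/-- The partial derivative `∂ᵢ u` at `y`. -/
def pd {m : ℕ} (i : Fin m) (u : Coord m → ℝ) (y : Coord m) : ℝ :=
  fderiv ℝ u y (EuclideanSpace.single i 1)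

/-- The Christoffel symbol `Γᵏᵢⱼ` of the metric with components `G`. -/
def christoffel {m : ℕ} (G : Coord m → Matrix (Fin m) (Fin m) ℝ) (k i j : Fin m)
    (y : Coord m) : ℝ :=
  (1 / 2 : ℝ) * ∑ l, (G y)⁻¹ k l *
    (pd i (fun z => G z j l) y + pd j (fun z => G z i l) y - pd l (fun z => G z i j) y)

/-- The component `Rᵢⱼ` of the Ricci tensor of the metric with components `G`. -/
def ricci {m : ℕ} (G : Coord m → Matrix (Fin m) (Fin m) ℝ) (i j : Fin m) (y : Coord m) : ℝ :=
  ∑ k, (pd k (christoffel G k i j) y - pd j (christoffel G k i k) y)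
    + ∑ k, ∑ l, (christoffel G k k l y * christoffel G l i j y
        - christoffel G k j l y * christoffel G l i k y)

/-- The component `∂ᵢ∂ⱼ u - Γᵏᵢⱼ ∂ₖ u` of the Hessian of `u`. -/
def hess {m : ℕ} (G : Coord m → Matrix (Fin m) (Fin m) ℝ) (u : Coord m → ℝ) (i j : Fin m)
    (y : Coord m) : ℝ :=
  pd i (pd j u) y - ∑ k, christoffel G k i j y * pd k u y

/-- The trace `gⁱʲ Bᵢⱼ` of a bilinear form with components `B`. -/
def metricTrace {m : ℕ} (G B : Matrix (Fin m) (Fin m) ℝ) : ℝ :=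
  ∑ i, ∑ j, G⁻¹ i j * B i j

/-- The pairing `⟨∇u, ∇v⟩ = gⁱʲ ∂ᵢu ∂ⱼv`. -/
def gradInner {m : ℕ} (G : Coord m → Matrix (Fin m) (Fin m) ℝ) (u v : Coord m → ℝ)
    (y : Coord m) : ℝ :=
  metricTrace (G y) (fun i j => pd i u y * pd j v y)

/-- The component `gⁱʲ (∂ᵢ∂ⱼ Φᵃ - Γᵏᵢⱼ ∂ₖ Φᵃ + Γ'ᵃ_{bc}(Φ) ∂ᵢΦᵇ ∂ⱼΦᶜ)` of the tension field
of a map `Φ` between coordinate domains with metrics `G` and `H`. -/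
def tension {m n : ℕ} (G : Coord m → Matrix (Fin m) (Fin m) ℝ)
    (H : Coord n → Matrix (Fin n) (Fin n) ℝ) (Φ : Coord m → Coord n) (a : Fin n)
    (y : Coord m) : ℝ :=
  metricTrace (G y) (fun i j => hess G (fun z => Φ z a) i j y
    + ∑ b, ∑ c, christoffel H a b c (Φ y)
        * pd i (fun z => Φ z b) y * pd j (fun z => Φ z c) y)

/-! ### Riemannian manifolds -/

/-- Smooth Riemannian metrics on a manifold `M` modelled on `ℝᵐ`. -/
abbrev RiemMetric (m : ℕ) (M : Type*) [TopologicalSpace M] [ChartedSpace (Coord m) M]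
    [IsManifold (𝓡 m) ∞ M] : Type _ :=
  ContMDiffRiemannianMetric (𝓡 m) ∞ (Coord m) (fun p : M => TangentSpace (𝓡 m) p)

section Domain

variable {m : ℕ} {M : Type*} [TopologicalSpace M] [ChartedSpace (Coord m) M]
  [IsManifold (𝓡 m) ∞ M]

/-- The coordinate vector field `∂ᵢ` of the chart `e`, at the point with coordinates `y`. -/
def coordVec (e : OpenPartialHomeomorph M (Coord m)) (y : Coord m) (i : Fin m) :
    TangentSpace (𝓡 m) (e.symm y) :=
  mfderiv (𝓡 m) (𝓡 m) e.symm y (EuclideanSpace.single i (1 : ℝ) : Coord m)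

/-- The components `gᵢⱼ = g(∂ᵢ, ∂ⱼ)` of the metric in the chart `e`. -/
def gram (g : RiemMetric m M) (e : OpenPartialHomeomorph M (Coord m)) (y : Coord m) :
    Matrix (Fin m) (Fin m) ℝ :=
  fun i j => g.inner (e.symm y) (coordVec e y i) (coordVec e y j)

/-- The Riemannian volume of the domain of the chart `e`, i.e. `√(det gᵢⱼ) dy`. -/
def chartVolume [MeasurableSpace M] (g : RiemMetric m M) (e : OpenPartialHomeomorph M (Coord m)) :
    Measure M :=
  Measure.map e.symm ((volume.restrict e.target).withDensity
    (fun y => ENNReal.ofReal (Real.sqrt (gram g e y).det)))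

/-- The Riemannian volume measure. The measures `chartVolume g e` agree on the overlaps of the
chart domains, so that their supremum is the measure which restricts to `chartVolume g e` on
the domain of each chart `e` of the smooth structure. -/
def riemannianVolume [MeasurableSpace M] (g : RiemMetric m M) : Measure M :=
  ⨆ e ∈ IsManifold.maximalAtlas (𝓡 m) ∞ M, chartVolume g e

/-- `‖∇f‖²`. -/
def gradNormSq (g : RiemMetric m M) (f : M → ℝ) (p : M) : ℝ :=
  let e := chartAt (Coord m) p
  gradInner (gram g e) (fun y => f (e.symm y)) (fun y => f (e.symm y)) (e p)

/-- The scalar curvature `R = gⁱʲ Rᵢⱼ`. -/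
def scalarCurvature (g : RiemMetric m M) (p : M) : ℝ :=
  let e := chartAt (Coord m) p
  metricTrace (gram g e (e p)) (fun i j => ricci (gram g e) i j (e p))

end Domain

section Map

variable {m n : ℕ} {M : Type*} [TopologicalSpace M] [ChartedSpace (Coord m) M]
  [IsManifold (𝓡 m) ∞ M] {N : Type*} [TopologicalSpace N] [ChartedSpace (Coord n) N]
  [IsManifold (𝓡 n) ∞ N]

/-- The components `h(dφ ∂ᵢ, dφ ∂ⱼ)` of the pull-back `∇φ ⊗ ∇φ = φ*h` in the chart `e`. -/
def pullback (h : RiemMetric n N) (φ : M → N) (e : OpenPartialHomeomorph M (Coord m))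
    (y : Coord m) : Matrix (Fin m) (Fin m) ℝ :=
  fun i j => h.inner (φ (e.symm y)) (mfderiv (𝓡 m) (𝓡 n) φ (e.symm y) (coordVec e y i))
    (mfderiv (𝓡 m) (𝓡 n) φ (e.symm y) (coordVec e y j))

/-- `|∇φ|² = gⁱʲ (φ*h)ᵢⱼ`. -/
def mapNormSq (g : RiemMetric m M) (h : RiemMetric n N) (φ : M → N) (p : M) : ℝ :=
  let e := chartAt (Coord m) p
  metricTrace (gram g e (e p)) (pullback h φ e (e p))

/-- The generalized scalar curvature `S = R - α |∇φ|²`. -/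
def genScalarCurvature (g : RiemMetric m M) (h : RiemMetric n N) (φ : M → N) (α : ℝ) (p : M) : ℝ :=
  scalarCurvature g p - α * mapNormSq g h φ p

/-- Harmonic-Einstein: `Ric - α ∇φ ⊗ ∇φ = lam g` and `τ φ = 0`, as identities between the
components in all charts of the two smooth structures. -/
structure IsHarmonicEinstein (g : RiemMetric m M) (h : RiemMetric n N) (φ : M → N) (α lam : ℝ) :
    Prop where
  einstein : ∀ e ∈ IsManifold.maximalAtlas (𝓡 m) ∞ M, ∀ y ∈ e.target, ∀ i j : Fin m,
    ricci (gram g e) i j y - α * pullback h φ e y i j = lam * gram g e y i j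
  harmonic : ∀ e ∈ IsManifold.maximalAtlas (𝓡 m) ∞ M,
    ∀ e' ∈ IsManifold.maximalAtlas (𝓡 n) ∞ N,
    ∀ y ∈ e.target, φ (e.symm y) ∈ e'.source → ∀ a : Fin n,
    tension (gram g e) (gram h e') (fun z => e' (φ (e.symm z))) a y = 0

/-- Ricci-harmonic soliton: `α ≥ 0`, `Ric - α ∇φ ⊗ ∇φ + Hess f = lam g` and
`τ φ = ⟨∇φ, ∇f⟩`, as identities between the components in all charts of the two smooth
structures. -/
structure IsRicciHarmonicSoliton (g : RiemMetric m M) (h : RiemMetric n N) (φ : M → N) (f : M → ℝ)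
    (α lam : ℝ) : Prop where
  coupling_nonneg : 0 ≤ α
  soliton : ∀ e ∈ IsManifold.maximalAtlas (𝓡 m) ∞ M, ∀ y ∈ e.target, ∀ i j : Fin m,
    ricci (gram g e) i j y - α * pullback h φ e y i j
      + hess (gram g e) (fun z => f (e.symm z)) i j y = lam * gram g e y i j
  map_eq : ∀ e ∈ IsManifold.maximalAtlas (𝓡 m) ∞ M,
    ∀ e' ∈ IsManifold.maximalAtlas (𝓡 n) ∞ N,
    ∀ y ∈ e.target, φ (e.symm y) ∈ e'.source → ∀ a : Fin n,
    tension (gram g e) (gram h e') (fun z => e' (φ (e.symm z))) a y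
      = gradInner (gram g e) (fun z => e' (φ (e.symm z)) a) (fun z => f (e.symm z)) y

end Map

end RicciHarmonic

end

/-!
Tracing the soliton equation gives `S = mλ - Δf`, and Hamilton's identity, a combination of the
contracted Bianchi identity with the divergence of the stress-energy tensor of `φ`, shows that
`S + |∇f|² - 2λf` is locally constant. At a maximum of `Δf`, Bochner's formula applied to this
identity yields `|Hess f|² ≤ λ Δf`; since `(Δf)² ≤ m |Hess f|²`, it follows that `Δf ≤ mλ`, that
is, `S ≥ 0`.

Let `F` be the locally constant function that maximizes `f` on each level set of Hamilton's
invariant, and put `u = F - f ≥ 0`. Then `S + |∇f|² + 2λu ≤ S_max`, and together with the gap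
inequality and `∫ S = mλ vol` this yields `mλ ∫ u ≤ ∫ |∇f|²`. By Green's formula this says
`∫ u S ≤ 0`, so `u S = 0` everywhere. Where `u` vanishes it is minimal, so `S = mλ + Δu > 0` there;
hence `{u ≠ 0} = {S ≤ 0}` is open and closed, and a minimum of `u` on it would have `S > 0`.
So `u = 0` and `f` is locally constant.
-/

namespace RicciHarmonic

/-! ### Partial derivatives -/

section PartialDerivatives

variable {m n : ℕ} {U V : Set (Coord m)} {u v : Coord m → ℝ} {y : Coord m}

theorem differentiableAt_of_contDiffOn (hU : IsOpen U) (hu : ContDiffOn ℝ ∞ u U) (hy : y ∈ U) :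
    DifferentiableAt ℝ u y :=
  (hu.contDiffAt (hU.mem_nhds hy)).differentiableAt (by simp)

theorem pd_congr (h : u =ᶠ[nhds y] v) (i : Fin m) : pd i u y = pd i v y := by
  rw [pd, pd, h.fderiv_eq]

theorem pd_congr_of_eqOn (hU : IsOpen U) (h : Set.EqOn u v U) (hy : y ∈ U) (i : Fin m) :
    pd i u y = pd i v y :=
  pd_congr (Filter.eventuallyEq_of_mem (hU.mem_nhds hy) h) i

theorem contDiffOn_pd (hU : IsOpen U) (hu : ContDiffOn ℝ ∞ u U) (i : Fin m) :
    ContDiffOn ℝ ∞ (pd i u) U :=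
  (hu.fderiv_of_isOpen (m := ∞) hU (by simp)).clm_apply contDiffOn_const

@[simp] theorem pd_const (c : ℝ) (i : Fin m) (y : Coord m) : pd i (fun _ => c) y = 0 := by
  simp [pd]

theorem pd_add (hu : DifferentiableAt ℝ u y) (hv : DifferentiableAt ℝ v y) (i : Fin m) :
    pd i (fun z => u z + v z) y = pd i u y + pd i v y := by
  simp [pd, fderiv_fun_add hu hv]

theorem pd_sub (hu : DifferentiableAt ℝ u y) (hv : DifferentiableAt ℝ v y) (i : Fin m) :
    pd i (fun z => u z - v z) y = pd i u y - pd i v y := by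
  simp [pd, fderiv_fun_sub hu hv]

theorem pd_mul (hu : DifferentiableAt ℝ u y) (hv : DifferentiableAt ℝ v y) (i : Fin m) :
    pd i (fun z => u z * v z) y = pd i u y * v y + u y * pd i v y := by
  simp only [pd, fderiv_fun_mul hu hv, add_apply,
    smul_apply, smul_eq_mul]
  ring

theorem pd_const_mul (hu : DifferentiableAt ℝ u y) (c : ℝ) (i : Fin m) :
    pd i (fun z => c * u z) y = c * pd i u y := by
  simp [pd, fderiv_const_mul hu]

theorem pd_sum {ι : Type*} {s : Finset ι} {w : ι → Coord m → ℝ}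
    (hw : ∀ k ∈ s, DifferentiableAt ℝ (w k) y) (i : Fin m) :
    pd i (fun z => ∑ k ∈ s, w k z) y = ∑ k ∈ s, pd i (w k) y := by
  simp [pd, fderiv_fun_sum hw]

theorem pd_coord (i j : Fin m) (y : Coord m) :
    pd i (fun z => z j) y = if j = i then 1 else 0 := by
  have h : HasFDerivAt (fun z : Coord m => z j) (EuclideanSpace.proj j : Coord m →L[ℝ] ℝ) y :=
    (EuclideanSpace.proj j : Coord m →L[ℝ] ℝ).hasFDerivAt
  simp [pd, h.fderiv]

theorem pd_comm (hU : IsOpen U) (hu : ContDiffOn ℝ ∞ u U) (hy : y ∈ U) (i j : Fin m) :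
    pd i (pd j u) y = pd j (pd i u) y := by
  have hc : ContDiffAt ℝ ∞ u y := hu.contDiffAt (hU.mem_nhds hy)
  have hs : IsSymmSndFDerivAt ℝ u y := hc.isSymmSndFDerivAt (by simpa using ENat.LEInfty.out)
  have hd : DifferentiableAt ℝ (fderiv ℝ u) y :=
    (hc.fderiv_right (m := ∞) (by simp)).differentiableAt (by simp)
  have pd_pd : ∀ i j : Fin m, pd i (pd j u) y
      = fderiv ℝ (fderiv ℝ u) y (EuclideanSpace.single i 1) (EuclideanSpace.single j 1) := by
    intro i j
    change fderiv ℝ (fun z => fderiv ℝ u z (EuclideanSpace.single j 1)) y _ = _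
    rw [fderiv_clm_apply hd (differentiableAt_const _)]
    simp
  rw [pd_pd, pd_pd, hs.eq]

theorem pd_pd_add (hU : IsOpen U) (hu : ContDiffOn ℝ ∞ u U) (hv : ContDiffOn ℝ ∞ v U)
    (hy : y ∈ U) (i j : Fin m) :
    pd i (pd j fun z => u z + v z) y = pd i (pd j u) y + pd i (pd j v) y := by
  have d {w : Coord m → ℝ} (hw : ContDiffOn ℝ ∞ w U) {z : Coord m} (hz : z ∈ U) :=
    differentiableAt_of_contDiffOn hU hw hz
  rw [pd_congr_of_eqOn hU (fun z hz => pd_add (d hu hz) (d hv hz) j) hy,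
    pd_add (d (contDiffOn_pd hU hu j) hy) (d (contDiffOn_pd hU hv j) hy)]

theorem pd_pd_sub (hU : IsOpen U) (hu : ContDiffOn ℝ ∞ u U) (hv : ContDiffOn ℝ ∞ v U)
    (hy : y ∈ U) (i j : Fin m) :
    pd i (pd j fun z => u z - v z) y = pd i (pd j u) y - pd i (pd j v) y := by
  have d {w : Coord m → ℝ} (hw : ContDiffOn ℝ ∞ w U) {z : Coord m} (hz : z ∈ U) :=
    differentiableAt_of_contDiffOn hU hw hz
  rw [pd_congr_of_eqOn hU (fun z hz => pd_sub (d hu hz) (d hv hz) j) hy,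
    pd_sub (d (contDiffOn_pd hU hu j) hy) (d (contDiffOn_pd hU hv j) hy)]

theorem pd_pd_const_mul (hU : IsOpen U) (hu : ContDiffOn ℝ ∞ u U) (hy : y ∈ U) (c : ℝ)
    (i j : Fin m) : pd i (pd j fun z => c * u z) y = c * pd i (pd j u) y := by
  have d {w : Coord m → ℝ} (hw : ContDiffOn ℝ ∞ w U) {z : Coord m} (hz : z ∈ U) :=
    differentiableAt_of_contDiffOn hU hw hz
  rw [pd_congr_of_eqOn hU (fun z hz => pd_const_mul (d hu hz) c j) hy,
    pd_const_mul (d (contDiffOn_pd hU hu j) hy)]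

theorem pd_pd_mul (hU : IsOpen U) (hu : ContDiffOn ℝ ∞ u U) (hv : ContDiffOn ℝ ∞ v U)
    (hy : y ∈ U) (i j : Fin m) :
    pd i (pd j fun z => u z * v z) y = pd i (pd j u) y * v y + pd j u y * pd i v y
      + (pd i u y * pd j v y + u y * pd i (pd j v) y) := by
  have d {w : Coord m → ℝ} (hw : ContDiffOn ℝ ∞ w U) {z : Coord m} (hz : z ∈ U) :=
    differentiableAt_of_contDiffOn hU hw hz
  have hu' := d (contDiffOn_pd hU hu j) hy
  have hv' := d (contDiffOn_pd hU hv j) hy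
  rw [pd_congr_of_eqOn hU (fun z hz => pd_mul (d hu hz) (d hv hz) j) hy,
    pd_add (hu'.fun_mul (d hv hy)) ((d hu hy).fun_mul hv'), pd_mul hu' (d hv hy),
    pd_mul (d hu hy) hv']

theorem pd_pd_sum {ι : Type*} {s : Finset ι} {w : ι → Coord m → ℝ} (hU : IsOpen U)
    (hw : ∀ k ∈ s, ContDiffOn ℝ ∞ (w k) U) (hy : y ∈ U) (i j : Fin m) :
    pd i (pd j fun z => ∑ k ∈ s, w k z) y = ∑ k ∈ s, pd i (pd j (w k)) y := by
  rw [pd_congr_of_eqOn hU (fun z hz => pd_sum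
    (fun k hk => differentiableAt_of_contDiffOn hU (hw k hk) hz) j) hy,
    pd_sum fun k hk => differentiableAt_of_contDiffOn hU (contDiffOn_pd hU (hw k hk) j) hy]

theorem fderiv_apply_eq_sum_pd (u : Coord m → ℝ) (y w : Coord m) :
    fderiv ℝ u y w = ∑ i, w i * pd i u y := by
  have hw : w = ∑ i, w i • (EuclideanSpace.single i (1 : ℝ) : Coord m) := by
    ext j
    simp [Finset.sum_apply, Pi.single_apply]
  conv_lhs => rw [hw]
  simp [pd]

theorem fderiv_eq_zero_iff_pd : fderiv ℝ u y = 0 ↔ ∀ i, pd i u y = 0 := by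
  refine ⟨fun h i => by rw [pd, h, zero_apply], fun h => ?_⟩
  ext w
  simp [fderiv_apply_eq_sum_pd, h]

/-- The Jacobian matrix `∂ᵢ ψᵃ`, with row index `a` and column index `i`. -/
noncomputable def jac (ψ : Coord m → Coord n) (z : Coord m) : Matrix (Fin n) (Fin m) ℝ :=
  .of fun a i => pd i (fun x => ψ x a) z

variable {ψ : Coord m → Coord n}

theorem contDiffOn_coord (hψ : ContDiffOn ℝ ∞ ψ U) (a : Fin n) :
    ContDiffOn ℝ ∞ (fun x => ψ x a) U :=
  (EuclideanSpace.proj a : Coord n →L[ℝ] ℝ).contDiff.comp_contDiffOn hψ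

theorem jac_apply (hψ : DifferentiableAt ℝ ψ y) (a : Fin n) (i : Fin m) :
    jac ψ y a i = fderiv ℝ ψ y (EuclideanSpace.single i 1) a := by
  have h := (EuclideanSpace.proj a : Coord n →L[ℝ] ℝ).hasFDerivAt.comp y hψ.hasFDerivAt
  exact congrArg (fun L => L (EuclideanSpace.single i 1)) h.fderiv

theorem pd_comp {u : Coord n → ℝ} (hψ : DifferentiableAt ℝ ψ y)
    (hu : DifferentiableAt ℝ u (ψ y)) (i : Fin m) :
    pd i (fun x => u (ψ x)) y = ∑ a, jac ψ y a i * pd a u (ψ y) := by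
  change fderiv ℝ (u ∘ ψ) y _ = _
  rw [fderiv_comp y hu hψ, ContinuousLinearMap.comp_apply, fderiv_apply_eq_sum_pd]
  simp only [jac_apply hψ]

theorem toLpLin_jac (hψ : DifferentiableAt ℝ ψ y) :
    Matrix.toLpLin 2 2 (jac ψ y) = (fderiv ℝ ψ y : Coord m →ₗ[ℝ] Coord n) := by
  refine (EuclideanSpace.basisFun (Fin m) ℝ).toBasis.ext fun i => ?_
  ext a
  simp [jac_apply hψ]

end PartialDerivatives

/-! ### Traces and determinants -/

section Matrices

variable {m : ℕ}

theorem metricTrace_eq_trace (G B : Matrix (Fin m) (Fin m) ℝ) :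
    metricTrace G B = (G⁻¹ * B.transpose).trace := by
  simp [metricTrace, Matrix.trace, Matrix.mul_apply]

theorem metricTrace_one (B : Matrix (Fin m) (Fin m) ℝ) : metricTrace 1 B = B.trace := by
  simp [metricTrace_eq_trace]

theorem metricTrace_self {G : Matrix (Fin m) (Fin m) ℝ} (hG : G.PosDef) :
    metricTrace G G = m := by
  have hsymm : G.transpose = G := by
    rw [← Matrix.conjTranspose_eq_transpose_of_trivial, hG.1.eq]
  rw [metricTrace_eq_trace, hsymm, Matrix.nonsing_inv_mul _ hG.det_pos.ne'.isUnit,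
    Matrix.trace_one, Fintype.card_fin]

theorem metricTrace_transpose_mul_mul (G B J : Matrix (Fin m) (Fin m) ℝ) (hJ : IsUnit J.det) :
    metricTrace (J.transpose * G * J) (J.transpose * B * J) = metricTrace G B := by
  have hJ' : IsUnit J.transpose.det := by rwa [Matrix.det_transpose]
  simp only [metricTrace_eq_trace, Matrix.transpose_mul, Matrix.mul_inv_rev,
    Matrix.transpose_transpose]
  calc (J⁻¹ * (G⁻¹ * J.transpose⁻¹) * (J.transpose * (B.transpose * J))).trace
      = (J⁻¹ * (G⁻¹ * (J.transpose⁻¹ * J.transpose) * B.transpose * J)).trace := by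
        simp only [Matrix.mul_assoc]
    _ = (G⁻¹ * B.transpose).trace := by
        rw [Matrix.nonsing_inv_mul _ hJ', Matrix.mul_one, Matrix.trace_mul_comm, Matrix.mul_assoc,
          Matrix.mul_nonsing_inv _ hJ, Matrix.mul_one]

theorem contDiffOn_det {ι : Type*} [Fintype ι] [DecidableEq ι] {U : Set (Coord m)}
    {A : Coord m → Matrix ι ι ℝ} (h : ∀ i j, ContDiffOn ℝ ∞ (fun z => A z i j) U) :
    ContDiffOn ℝ ∞ (fun z => (A z).det) U := by
  simp only [Matrix.det_apply, Units.smul_def, zsmul_eq_mul]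
  exact ContDiffOn.sum fun σ _ => contDiffOn_const.mul (contDiffOn_prod fun i _ => h _ _)

end Matrices

/-! ### Smooth metrics on open subsets of the coordinate space -/

/-- `G` is a smooth Riemannian metric on the open set `U`. -/
structure IsMetricOn {m : ℕ} (G : Coord m → Matrix (Fin m) (Fin m) ℝ) (U : Set (Coord m)) :
    Prop where
  isOpen : IsOpen U
  smooth : ∀ i j, ContDiffOn ℝ ∞ (fun z => G z i j) U
  posDef : ∀ z ∈ U, (G z).PosDef

/-- The Laplacian `gⁱʲ (Hess u)ᵢⱼ` of the metric with components `G`. -/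
noncomputable def coordLaplacian {m : ℕ} (G : Coord m → Matrix (Fin m) (Fin m) ℝ)
    (u : Coord m → ℝ) (y : Coord m) : ℝ :=
  metricTrace (G y) (fun i j => hess G u i j y)

/-- The components `gᵏˡ ∂ₗu` of the gradient of `u`. -/
noncomputable def grad {m : ℕ} (G : Coord m → Matrix (Fin m) (Fin m) ℝ) (u : Coord m → ℝ)
    (y : Coord m) : Fin m → ℝ :=
  (G y)⁻¹.mulVec fun l => pd l u y

/-- The Christoffel symbol of the first kind `Γₗ,ᵢⱼ = gₗₖ Γᵏᵢⱼ`. -/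
noncomputable def christoffelFirst {m : ℕ} (G : Coord m → Matrix (Fin m) (Fin m) ℝ)
    (l i j : Fin m) (y : Coord m) : ℝ :=
  (1 / 2 : ℝ) *
    (pd i (fun z => G z j l) y + pd j (fun z => G z i l) y - pd l (fun z => G z i j) y)

/-- The matrix `(Γᵢ)ᵏⱼ = Γᵏᵢⱼ` of the Levi-Civita connection in the direction `∂ᵢ`. -/
noncomputable def connectionMatrix {m : ℕ} (G : Coord m → Matrix (Fin m) (Fin m) ℝ) (i : Fin m)
    (y : Coord m) : Matrix (Fin m) (Fin m) ℝ :=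
  .of fun k j => christoffel G k i j y

/-- The entrywise partial derivative `∂ᵢA` of a matrix-valued function. -/
noncomputable def pdMatrix {m : ℕ} (i : Fin m) (A : Coord m → Matrix (Fin m) (Fin m) ℝ)
    (y : Coord m) : Matrix (Fin m) (Fin m) ℝ :=
  .of fun k l => pd i (fun z => A z k l) y

theorem christoffel_eq_sum {m : ℕ} (G : Coord m → Matrix (Fin m) (Fin m) ℝ) (k i j : Fin m)
    (y : Coord m) : christoffel G k i j y = ∑ l, (G y)⁻¹ k l * christoffelFirst G l i j y := by
  simp only [christoffel, christoffelFirst, Finset.mul_sum, mul_left_comm]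

theorem gradInner_eq_dotProduct {m : ℕ} (G : Coord m → Matrix (Fin m) (Fin m) ℝ)
    (u v : Coord m → ℝ) (y : Coord m) :
    gradInner G u v y = (fun k => pd k u y) ⬝ᵥ grad G v y := by
  simp only [gradInner, metricTrace, grad, Matrix.mulVec, dotProduct, Finset.mul_sum]
  exact Finset.sum_congr rfl fun k _ => Finset.sum_congr rfl fun l _ => by ring

theorem gradInner_self_nonneg {m : ℕ} {G : Coord m → Matrix (Fin m) (Fin m) ℝ} {y : Coord m}
    (hG : (G y).PosDef) (u : Coord m → ℝ) : 0 ≤ gradInner G u u y := by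
  rw [gradInner_eq_dotProduct, grad]
  simpa using hG.inv.posSemidef.dotProduct_mulVec_nonneg fun k => pd k u y

theorem pdMatrix_mul {m : ℕ} {A B : Coord m → Matrix (Fin m) (Fin m) ℝ} {y : Coord m}
    (hA : ∀ k l, DifferentiableAt ℝ (fun z => A z k l) y)
    (hB : ∀ k l, DifferentiableAt ℝ (fun z => B z k l) y) (i : Fin m) :
    pdMatrix i (fun z => A z * B z) y = pdMatrix i A y * B y + A y * pdMatrix i B y := by
  ext k l
  simp only [pdMatrix, Matrix.of_apply, Matrix.mul_apply, Matrix.add_apply]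
  rw [pd_sum fun j _ => (hA k j).fun_mul (hB j l), ← Finset.sum_add_distrib]
  exact Finset.sum_congr rfl fun j _ => pd_mul (hA k j) (hB j l) i

namespace IsMetricOn

variable {m : ℕ} {G : Coord m → Matrix (Fin m) (Fin m) ℝ} {U : Set (Coord m)}
  {u v : Coord m → ℝ} {y : Coord m}

theorem mono {V : Set (Coord m)} (hG : IsMetricOn G U) (hV : IsOpen V) (h : V ⊆ U) :
    IsMetricOn G V where
  isOpen := hV
  smooth i j := (hG.smooth i j).mono h
  posDef z hz := hG.posDef z (h hz)

theorem transpose_eq (hG : IsMetricOn G U) (hy : y ∈ U) : (G y).transpose = G y := by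
  rw [← Matrix.conjTranspose_eq_transpose_of_trivial, (hG.posDef y hy).1.eq]

theorem transpose_inv_eq (hG : IsMetricOn G U) (hy : y ∈ U) : (G y)⁻¹.transpose = (G y)⁻¹ := by
  rw [Matrix.transpose_nonsing_inv, hG.transpose_eq hy]

theorem isUnit_det (hG : IsMetricOn G U) (hy : y ∈ U) : IsUnit (G y).det :=
  (hG.posDef y hy).det_pos.ne'.isUnit

theorem inv_mul (hG : IsMetricOn G U) (hy : y ∈ U) : (G y)⁻¹ * G y = 1 :=
  Matrix.nonsing_inv_mul _ (hG.isUnit_det hy)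

theorem mul_inv (hG : IsMetricOn G U) (hy : y ∈ U) : G y * (G y)⁻¹ = 1 :=
  Matrix.mul_nonsing_inv _ (hG.isUnit_det hy)

theorem contDiffOn_inv (hG : IsMetricOn G U) (k l : Fin m) :
    ContDiffOn ℝ ∞ (fun z => (G z)⁻¹ k l) U := by
  have hadj : ContDiffOn ℝ ∞ (fun z => (G z).adjugate k l) U := by
    simp only [Matrix.adjugate_apply]
    refine contDiffOn_det fun i j => ?_
    rcases eq_or_ne i l with rfl | h
    · simpa only [Matrix.updateRow_self] using contDiffOn_const
    · simpa only [Matrix.updateRow_ne h] using hG.smooth i j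
  have hdet := (contDiffOn_det hG.smooth).inv fun z hz => (hG.posDef z hz).det_pos.ne'
  exact (hdet.mul hadj).congr fun z _ => by simp [Matrix.inv_def]

theorem contDiffOn_christoffelFirst (hG : IsMetricOn G U) (l i j : Fin m) :
    ContDiffOn ℝ ∞ (christoffelFirst G l i j) U :=
  have hpd (l i j : Fin m) := contDiffOn_pd hG.isOpen (hG.smooth i j) l
  contDiffOn_const.mul (((hpd i j l).add (hpd j i l)).sub (hpd l i j))

theorem contDiffOn_christoffel (hG : IsMetricOn G U) (k i j : Fin m) :
    ContDiffOn ℝ ∞ (christoffel G k i j) U := by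
  simp only [funext (christoffel_eq_sum G k i j)]
  exact ContDiffOn.sum fun l _ => (hG.contDiffOn_inv k l).mul (hG.contDiffOn_christoffelFirst l i j)

theorem contDiffOn_hess (hG : IsMetricOn G U) (hu : ContDiffOn ℝ ∞ u U) (i j : Fin m) :
    ContDiffOn ℝ ∞ (hess G u i j) U :=
  (contDiffOn_pd hG.isOpen (contDiffOn_pd hG.isOpen hu j) i).sub (ContDiffOn.sum fun k _ =>
    (hG.contDiffOn_christoffel k i j).mul (contDiffOn_pd hG.isOpen hu k))

theorem contDiffOn_gradInner (hG : IsMetricOn G U) (hu : ContDiffOn ℝ ∞ u U)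
    (hv : ContDiffOn ℝ ∞ v U) : ContDiffOn ℝ ∞ (gradInner G u v) U := by
  unfold gradInner metricTrace
  exact ContDiffOn.sum fun i _ => ContDiffOn.sum fun j _ => (hG.contDiffOn_inv i j).mul
    ((contDiffOn_pd hG.isOpen hu i).mul (contDiffOn_pd hG.isOpen hv j))

theorem contDiffOn_coordLaplacian (hG : IsMetricOn G U) (hu : ContDiffOn ℝ ∞ u U) :
    ContDiffOn ℝ ∞ (coordLaplacian G u) U := by
  unfold coordLaplacian metricTrace
  exact ContDiffOn.sum fun i _ => ContDiffOn.sum fun j _ => (hG.contDiffOn_inv i j).mul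
    (hG.contDiffOn_hess hu i j)

theorem contDiffOn_ricci (hG : IsMetricOn G U) (i j : Fin m) :
    ContDiffOn ℝ ∞ (ricci G i j) U :=
  have hΓ := hG.contDiffOn_christoffel
  (ContDiffOn.sum fun k _ => (contDiffOn_pd hG.isOpen (hΓ k i j) k).sub
    (contDiffOn_pd hG.isOpen (hΓ k i k) j)).add
    (ContDiffOn.sum fun k _ => ContDiffOn.sum fun l _ =>
      ((hΓ k k l).mul (hΓ l i j)).sub ((hΓ k j l).mul (hΓ l i k)))

theorem pd_symm (hG : IsMetricOn G U) (hy : y ∈ U) (l i j : Fin m) :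
    pd l (fun z => G z i j) y = pd l (fun z => G z j i) y :=
  pd_congr_of_eqOn hG.isOpen (fun _ hz => (congrFun₂ (hG.transpose_eq hz) i j).symm) hy l

theorem christoffel_symm (hG : IsMetricOn G U) (hy : y ∈ U) (k i j : Fin m) :
    christoffel G k i j y = christoffel G k j i y := by
  simp only [christoffel]
  congr 1
  exact Finset.sum_congr rfl fun l _ => by rw [hG.pd_symm hy l i j]; ring

theorem hess_symm (hG : IsMetricOn G U) (hu : ContDiffOn ℝ ∞ u U) (hy : y ∈ U) (i j : Fin m) :
    hess G u i j y = hess G u j i y := by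
  simp only [hess, hG.christoffel_symm hy _ i j, pd_comm hG.isOpen hu hy i j]

theorem gradInner_comm (hG : IsMetricOn G U) (hy : y ∈ U) (u v : Coord m → ℝ) :
    gradInner G u v y = gradInner G v u y := by
  rw [gradInner_eq_dotProduct, gradInner_eq_dotProduct, grad, grad, Matrix.dotProduct_mulVec,
    ← Matrix.mulVec_transpose, hG.transpose_inv_eq hy, dotProduct_comm]

theorem mul_connectionMatrix_apply (hG : IsMetricOn G U) (hy : y ∈ U) (i b j : Fin m) :
    (G y * connectionMatrix G i y) b j = christoffelFirst G b i j y := by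
  have hlower : (G y).mulVec (fun k => christoffel G k i j y)
      = fun l => christoffelFirst G l i j y := by
    simp only [christoffel_eq_sum, ← dotProduct.eq_def]
    exact (Matrix.mulVec_mulVec _ _ _).trans (by rw [hG.mul_inv hy, Matrix.one_mulVec])
  exact congrFun hlower b

theorem pdMatrix_eq (hG : IsMetricOn G U) (hy : y ∈ U) (i : Fin m) :
    pdMatrix i G y = G y * connectionMatrix G i y + (G y * connectionMatrix G i y).transpose := by
  ext a b
  rw [Matrix.add_apply, Matrix.transpose_apply, hG.mul_connectionMatrix_apply hy,
    hG.mul_connectionMatrix_apply hy, christoffelFirst, christoffelFirst, hG.pd_symm hy i b a,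
    pdMatrix, Matrix.of_apply, hG.pd_symm hy b i a, hG.pd_symm hy a i b]
  ring

theorem pdMatrix_inv_mul (hG : IsMetricOn G U) (hy : y ∈ U) (i : Fin m) :
    pdMatrix i (fun z => (G z)⁻¹) y * G y = -((G y)⁻¹ * pdMatrix i G y) := by
  have hI k l := differentiableAt_of_contDiffOn hG.isOpen (hG.contDiffOn_inv k l) hy
  have hd k l := differentiableAt_of_contDiffOn hG.isOpen (hG.smooth k l) hy
  rw [eq_neg_iff_add_eq_zero, ← pdMatrix_mul hI hd]
  ext k l
  simp only [pdMatrix, Matrix.of_apply]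
  rw [pd_congr_of_eqOn hG.isOpen (fun z hz => congrFun₂ (hG.inv_mul hz) k l) hy, pd_const]
  rfl

theorem pdMatrix_inv (hG : IsMetricOn G U) (hy : y ∈ U) (i : Fin m) :
    pdMatrix i (fun z => (G z)⁻¹) y
      = -(connectionMatrix G i y * (G y)⁻¹ + (connectionMatrix G i y * (G y)⁻¹).transpose) := by
  calc pdMatrix i (fun z => (G z)⁻¹) y
      = pdMatrix i (fun z => (G z)⁻¹) y * G y * (G y)⁻¹ := by
        rw [Matrix.mul_assoc, hG.mul_inv hy, Matrix.mul_one]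
    _ = -((G y)⁻¹ * pdMatrix i G y * (G y)⁻¹) := by
        rw [hG.pdMatrix_inv_mul hy, Matrix.neg_mul]
    _ = _ := by
        rw [hG.pdMatrix_eq hy, Matrix.mul_add, Matrix.add_mul, ← Matrix.mul_assoc, hG.inv_mul hy,
          Matrix.one_mul, Matrix.transpose_mul, Matrix.transpose_mul, hG.transpose_eq hy,
          hG.transpose_inv_eq hy, Matrix.mul_assoc _ _ (G y)⁻¹, Matrix.mul_assoc _ (G y),
          hG.mul_inv hy, Matrix.mul_one]

theorem hess_eq_sub_vecMul (G : Coord m → Matrix (Fin m) (Fin m) ℝ) (u : Coord m → ℝ) (i : Fin m)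
    (y : Coord m) :
    (fun k => hess G u i k y)
      = (fun k => pd i (pd k u) y)
        - Matrix.vecMul (fun k => pd k u y) (connectionMatrix G i y) := by
  ext k
  simp only [hess, connectionMatrix, Pi.sub_apply, Matrix.vecMul, dotProduct, Matrix.of_apply]
  simp only [mul_comm]

theorem pd_gradInner (hG : IsMetricOn G U) (hu : ContDiffOn ℝ ∞ u U) (hv : ContDiffOn ℝ ∞ v U)
    (hy : y ∈ U) (i : Fin m) :
    pd i (gradInner G u v) y
      = (fun k => hess G u i k y) ⬝ᵥ grad G v y + (fun k => hess G v i k y) ⬝ᵥ grad G u y := by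
  have hI k l := differentiableAt_of_contDiffOn hG.isOpen (hG.contDiffOn_inv k l) hy
  have hdu k := differentiableAt_of_contDiffOn hG.isOpen (contDiffOn_pd hG.isOpen hu k) hy
  have hdv k := differentiableAt_of_contDiffOn hG.isOpen (contDiffOn_pd hG.isOpen hv k) hy
  have leibniz : pd i (gradInner G u v) y
      = (fun k => pd i (pd k u) y) ⬝ᵥ grad G v y + (fun k => pd i (pd k v) y) ⬝ᵥ grad G u y
        + (fun k => pd k u y) ⬝ᵥ (pdMatrix i (fun z => (G z)⁻¹) y).mulVec fun l => pd l v y := by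
    change pd i (fun z => ∑ k, ∑ l, (G z)⁻¹ k l * (pd k u z * pd l v z)) y = _
    have hterm k l : pd i (fun z => (G z)⁻¹ k l * (pd k u z * pd l v z)) y
        = pd i (pd k u) y * ((G y)⁻¹ k l * pd l v y) + pd i (pd l v) y * ((G y)⁻¹ l k * pd k u y)
          + pd k u y * (pd i (fun z => (G z)⁻¹ k l) y * pd l v y) := by
      rw [pd_mul (hI k l) ((hdu k).fun_mul (hdv l)), pd_mul (hdu k) (hdv l),
        show (G y)⁻¹ l k = (G y)⁻¹ k l from congrFun₂ (hG.transpose_inv_eq hy) k l]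
      ring
    rw [pd_sum fun k _ => DifferentiableAt.fun_sum fun l _ =>
      (hI k l).fun_mul ((hdu k).fun_mul (hdv l))]
    simp only [pd_sum fun l (_ : l ∈ Finset.univ) => (hI _ l).fun_mul ((hdu _).fun_mul (hdv l)),
      hterm, Finset.sum_add_distrib, grad, pdMatrix, Matrix.of_apply, Matrix.mulVec, dotProduct,
      Finset.mul_sum]
    congr 2
    exact Finset.sum_comm
  rw [leibniz, hG.pdMatrix_inv hy, hess_eq_sub_vecMul, hess_eq_sub_vecMul, sub_dotProduct,
    sub_dotProduct, ← Matrix.dotProduct_mulVec, ← Matrix.dotProduct_mulVec, grad, grad,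
    Matrix.neg_mulVec, Matrix.add_mulVec, dotProduct_neg, dotProduct_add, Matrix.mulVec_mulVec,
    Matrix.mulVec_mulVec, Matrix.mulVec_transpose, dotProduct_comm _ (Matrix.vecMul _ _),
    ← Matrix.dotProduct_mulVec]
  ring

end IsMetricOn

/-! ### Change of coordinates -/

/-- The matrix `(Hess u)ᵢⱼ` of the Hessian. -/
noncomputable def hessMatrix {m : ℕ} (G : Coord m → Matrix (Fin m) (Fin m) ℝ) (u : Coord m → ℝ)
    (y : Coord m) : Matrix (Fin m) (Fin m) ℝ :=
  .of fun i j => hess G u i j y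

/-- The components of the pull-back of the metric `H` under `Φ`. -/
noncomputable def coordPullback {m n : ℕ} (H : Coord n → Matrix (Fin n) (Fin n) ℝ)
    (Φ : Coord m → Coord n) (z : Coord m) : Matrix (Fin m) (Fin m) ℝ :=
  (jac Φ z).transpose * H (Φ z) * jac Φ z

/-- `ψ` maps `V` smoothly to `U` and pulls the metric `G` on `U` back to the metric `G'` on `V`.
This is how the components of one metric in two coordinate systems are related. -/
structure IsIsometryOn {m : ℕ} (ψ : Coord m → Coord m) (G' G : Coord m → Matrix (Fin m) (Fin m) ℝ)
    (V U : Set (Coord m)) : Prop where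
  source : IsMetricOn G' V
  target : IsMetricOn G U
  contDiffOn : ContDiffOn ℝ ∞ ψ V
  mapsTo : Set.MapsTo ψ V U
  pullback_eq : ∀ x ∈ V, G' x = coordPullback G ψ x

section

variable {m : ℕ} {G : Coord m → Matrix (Fin m) (Fin m) ℝ} {U : Set (Coord m)}
  {u v w : Coord m → ℝ} {y : Coord m}

theorem gradInner_congr_right (h : v =ᶠ[nhds y] w) :
    gradInner G u v y = gradInner G u w y := by
  simp only [gradInner, pd_congr h]

theorem IsMetricOn.gradInner_gradInner (hG : IsMetricOn G U) (hv : ContDiffOn ℝ ∞ v U)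
    (hw : ContDiffOn ℝ ∞ w U) (hy : y ∈ U) :
    gradInner G u (gradInner G v w) y
      = grad G u y ⬝ᵥ (hessMatrix G v y).mulVec (grad G w y)
        + grad G u y ⬝ᵥ (hessMatrix G w y).mulVec (grad G v y) := by
  rw [hG.gradInner_comm hy, gradInner_eq_dotProduct, dotProduct_comm, ← dotProduct_add]
  congr 1
  ext i
  exact hG.pd_gradInner hv hw hy i

theorem IsMetricOn.grad_hess_grad_comm (hG : IsMetricOn G U) (hu : ContDiffOn ℝ ∞ u U)
    (hy : y ∈ U) (p q : Fin m → ℝ) :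
    p ⬝ᵥ (hessMatrix G u y).mulVec q = q ⬝ᵥ (hessMatrix G u y).mulVec p := by
  have hsymm : (hessMatrix G u y).transpose = hessMatrix G u y :=
    Matrix.ext fun i j => hG.hess_symm hu hy j i
  rw [Matrix.dotProduct_mulVec, ← Matrix.mulVec_transpose, hsymm, dotProduct_comm]

theorem IsMetricOn.two_mul_hess_grad_grad (hG : IsMetricOn G U) (hu : ContDiffOn ℝ ∞ u U)
    (hv : ContDiffOn ℝ ∞ v U) (hw : ContDiffOn ℝ ∞ w U) (hy : y ∈ U) :
    2 * (grad G v y ⬝ᵥ (hessMatrix G u y).mulVec (grad G w y))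
      = gradInner G v (gradInner G u w) y + gradInner G w (gradInner G u v) y
        - gradInner G u (gradInner G v w) y := by
  rw [hG.gradInner_gradInner hu hw hy, hG.gradInner_gradInner hu hv hy,
    hG.gradInner_gradInner hv hw hy, hG.grad_hess_grad_comm hu hy (grad G w y),
    hG.grad_hess_grad_comm hw hy (grad G v y), hG.grad_hess_grad_comm hv hy (grad G w y)]
  ring

theorem IsMetricOn.exists_grad_eq (hG : IsMetricOn G U) (hy : y ∈ U) (p : Fin m → ℝ) :
    ∃ v : Coord m → ℝ, ContDiff ℝ ∞ v ∧ grad G v y = p := by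
  have hcoord (j : Fin m) : ContDiff ℝ ∞ fun x : Coord m => x j :=
    (EuclideanSpace.proj j : Coord m →L[ℝ] ℝ).contDiff
  have hdiff (j : Fin m) : DifferentiableAt ℝ (fun x : Coord m => x j) y :=
    (hcoord j).differentiable (by simp) y
  refine ⟨fun x => ∑ j, (G y).mulVec p j * x j,
    ContDiff.sum fun j _ => contDiff_const.mul (hcoord j), ?_⟩
  have hpd : (fun l => pd l (fun x => ∑ j, (G y).mulVec p j * x j) y) = (G y).mulVec p := by
    ext l
    rw [pd_sum fun j _ => (hdiff j).const_mul _]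
    simp [pd_const_mul (hdiff _), pd_coord]
  rw [grad, hpd, Matrix.mulVec_mulVec, hG.inv_mul hy, Matrix.one_mulVec]

end

namespace IsIsometryOn

variable {m : ℕ} {G G' : Coord m → Matrix (Fin m) (Fin m) ℝ} {U V : Set (Coord m)}
  {ψ : Coord m → Coord m} {z : Coord m} {u v : Coord m → ℝ}

theorem isUnit_det_jac (h : IsIsometryOn ψ G' G V U) (hz : z ∈ V) : IsUnit (jac ψ z).det := by
  have hdet := (h.source.posDef z hz).det_pos.ne'
  rw [h.pullback_eq z hz, coordPullback, Matrix.det_mul] at hdet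
  exact (right_ne_zero_of_mul hdet).isUnit

theorem differentiableAt (h : IsIsometryOn ψ G' G V U) (hz : z ∈ V) : DifferentiableAt ℝ ψ z :=
  (h.contDiffOn.contDiffAt (h.source.isOpen.mem_nhds hz)).differentiableAt (by simp)

theorem contDiffOn_comp (h : IsIsometryOn ψ G' G V U) (hu : ContDiffOn ℝ ∞ u U) :
    ContDiffOn ℝ ∞ (fun x => u (ψ x)) V :=
  hu.comp h.contDiffOn h.mapsTo

theorem mul_inv_mul_transpose (h : IsIsometryOn ψ G' G V U) (hz : z ∈ V) :
    jac ψ z * (G' z)⁻¹ * (jac ψ z).transpose = (G (ψ z))⁻¹ := by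
  have hJ := h.isUnit_det_jac hz
  have hJ' : IsUnit (jac ψ z).transpose.det := by rwa [Matrix.det_transpose]
  rw [h.pullback_eq z hz, coordPullback, Matrix.mul_inv_rev, Matrix.mul_inv_rev, ← Matrix.mul_assoc,
    Matrix.mul_nonsing_inv _ hJ, Matrix.one_mul, Matrix.mul_assoc, Matrix.nonsing_inv_mul _ hJ',
    Matrix.mul_one]

theorem pd_comp_eq_vecMul (h : IsIsometryOn ψ G' G V U) (hz : z ∈ V)
    (hu : DifferentiableAt ℝ u (ψ z)) :
    (fun i => pd i (fun x => u (ψ x)) z)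
      = Matrix.vecMul (fun a => pd a u (ψ z)) (jac ψ z) := by
  ext i
  rw [pd_comp (h.differentiableAt hz) hu]
  exact Finset.sum_congr rfl fun a _ => mul_comm _ _

theorem jac_mulVec_grad (h : IsIsometryOn ψ G' G V U) (hz : z ∈ V)
    (hu : DifferentiableAt ℝ u (ψ z)) :
    (jac ψ z).mulVec (grad G' (fun x => u (ψ x)) z) = grad G u (ψ z) := by
  rw [grad, h.pd_comp_eq_vecMul hz hu, ← Matrix.mulVec_transpose, Matrix.mulVec_mulVec,
    Matrix.mulVec_mulVec, h.mul_inv_mul_transpose hz, grad]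

theorem gradInner_comp (h : IsIsometryOn ψ G' G V U) (hz : z ∈ V)
    (hu : DifferentiableAt ℝ u (ψ z)) (hv : DifferentiableAt ℝ v (ψ z)) :
    gradInner G' (fun x => u (ψ x)) (fun x => v (ψ x)) z = gradInner G u v (ψ z) := by
  rw [gradInner_eq_dotProduct, gradInner_eq_dotProduct, h.pd_comp_eq_vecMul hz hu,
    ← Matrix.dotProduct_mulVec, h.jac_mulVec_grad hz hv]

theorem hess_grad_grad_comp {w : Coord m → ℝ} (h : IsIsometryOn ψ G' G V U) (hz : z ∈ V)
    (hu : ContDiffOn ℝ ∞ u U) (hv : ContDiffOn ℝ ∞ v U) (hw : ContDiffOn ℝ ∞ w U) :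
    grad G' (fun x => v (ψ x)) z
        ⬝ᵥ (hessMatrix G' (fun x => u (ψ x)) z).mulVec (grad G' (fun x => w (ψ x)) z)
      = grad G v (ψ z) ⬝ᵥ (hessMatrix G u (ψ z)).mulVec (grad G w (ψ z)) := by
  have d {f : Coord m → ℝ} (hf : ContDiffOn ℝ ∞ f U) {x : Coord m} (hx : x ∈ V) :
      DifferentiableAt ℝ f (ψ x) :=
    differentiableAt_of_contDiffOn h.target.isOpen hf (h.mapsTo hx)
  have nested {a b c : Coord m → ℝ} (ha : ContDiffOn ℝ ∞ a U) (hb : ContDiffOn ℝ ∞ b U)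
      (hc : ContDiffOn ℝ ∞ c U) :
      gradInner G' (fun x => a (ψ x)) (gradInner G' (fun x => b (ψ x)) fun x => c (ψ x)) z
        = gradInner G a (gradInner G b c) (ψ z) := by
    rw [← h.gradInner_comp hz (d ha hz) (d (h.target.contDiffOn_gradInner hb hc) hz)]
    exact gradInner_congr_right (Filter.eventuallyEq_of_mem (h.source.isOpen.mem_nhds hz)
      fun x hx => h.gradInner_comp hx (d hb hx) (d hc hx))
  -- By the Koszul formula the Hessian is determined by the pairing of gradients.
  have koszul := h.source.two_mul_hess_grad_grad (h.contDiffOn_comp hu) (h.contDiffOn_comp hv)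
    (h.contDiffOn_comp hw) hz
  rw [nested hv hu hw, nested hw hu hv, nested hu hv hw,
    ← h.target.two_mul_hess_grad_grad hu hv hw (h.mapsTo hz)] at koszul
  linarith

theorem hessMatrix_comp (h : IsIsometryOn ψ G' G V U) (hz : z ∈ V) (hu : ContDiffOn ℝ ∞ u U) :
    hessMatrix G' (fun x => u (ψ x)) z
      = (jac ψ z).transpose * hessMatrix G u (ψ z) * jac ψ z := by
  have exists_grad (p : Fin m → ℝ) : ∃ v : Coord m → ℝ, ContDiffOn ℝ ∞ v U
      ∧ grad G v (ψ z) = (jac ψ z).mulVec p ∧ grad G' (fun x => v (ψ x)) z = p := by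
    obtain ⟨v, hv, hgrad⟩ := h.target.exists_grad_eq (h.mapsTo hz) ((jac ψ z).mulVec p)
    refine ⟨v, hv.contDiffOn, hgrad, ?_⟩
    have hJ := Matrix.mulVec_injective_of_isUnit
      ((Matrix.isUnit_iff_isUnit_det _).2 (h.isUnit_det_jac hz))
    exact hJ ((h.jac_mulVec_grad hz (hv.differentiable (by simp) _)).trans hgrad)
  ext i j
  obtain ⟨v, hv, hgv, hgv'⟩ := exists_grad (Pi.single i 1)
  obtain ⟨w, hw, hgw, hgw'⟩ := exists_grad (Pi.single j 1)
  have key := h.hess_grad_grad_comp hz hu hv hw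
  rw [hgv, hgv', hgw, hgw', Matrix.mulVec_mulVec, ← Matrix.vecMul_transpose (jac ψ z),
    ← Matrix.dotProduct_mulVec, Matrix.mulVec_mulVec, ← Matrix.mul_assoc] at key
  simpa using key

theorem coordLaplacian_comp (h : IsIsometryOn ψ G' G V U) (hz : z ∈ V)
    (hu : ContDiffOn ℝ ∞ u U) :
    coordLaplacian G' (fun x => u (ψ x)) z = coordLaplacian G u (ψ z) := by
  change metricTrace (G' z) (hessMatrix G' (fun x => u (ψ x)) z)
    = metricTrace (G (ψ z)) (hessMatrix G u (ψ z))
  rw [h.hessMatrix_comp hz hu, h.pullback_eq z hz, coordPullback,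
    metricTrace_transpose_mul_mul _ _ _ (h.isUnit_det_jac hz)]

end IsIsometryOn

/-! ### Normal coordinates -/

/-- The coordinates are normal at `y` up to first order: `G = 1` and `dG = 0` at `y`. -/
structure IsNormalAt {m : ℕ} (G : Coord m → Matrix (Fin m) (Fin m) ℝ) (U : Set (Coord m))
    (y : Coord m) : Prop where
  metric : IsMetricOn G U
  mem : y ∈ U
  eq_one : G y = 1
  pd_eq_zero : ∀ l i j, pd l (fun z => G z i j) y = 0

section

variable {m : ℕ} {G : Coord m → Matrix (Fin m) (Fin m) ℝ} {U : Set (Coord m)}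
  {u v : Coord m → ℝ} {y : Coord m}

theorem pd_mul_eq_zero (hu : DifferentiableAt ℝ u y) (hv : DifferentiableAt ℝ v y)
    (hu0 : u y = 0) (hv0 : v y = 0) (i : Fin m) : pd i (fun z => u z * v z) y = 0 := by
  rw [pd_mul hu hv, hu0, hv0, mul_zero, zero_mul, add_zero]

theorem pd_sum_mul_of_eq_one {n : ℕ} {A : Coord m → Matrix (Fin n) (Fin n) ℝ}
    {X : Fin n → Coord m → ℝ} {i : Fin m} (hA : ∀ k l, DifferentiableAt ℝ (fun z => A z k l) y)
    (hX : ∀ l, DifferentiableAt ℝ (X l) y) (hA1 : A y = 1)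
    (hA0 : ∀ k l, pd i (fun z => A z k l) y = 0) (k : Fin n) :
    pd i (fun z => ∑ l, A z k l * X l z) y = pd i (X k) y := by
  rw [pd_sum fun l _ => (hA k l).fun_mul (hX l)]
  simp [pd_mul (hA k _) (hX _), hA0, hA1, Matrix.one_apply]

theorem IsMetricOn.pd_christoffelFirst (hG : IsMetricOn G U) (hy : y ∈ U) (l k i j : Fin m) :
    pd l (christoffelFirst G k i j) y = (1 / 2 : ℝ) * (pd l (pd i fun z => G z j k) y
      + pd l (pd j fun z => G z i k) y - pd l (pd k fun z => G z i j) y) := by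
  have hd (l i j : Fin m) : DifferentiableAt ℝ (pd l fun z => G z i j) y :=
    differentiableAt_of_contDiffOn hG.isOpen (contDiffOn_pd hG.isOpen (hG.smooth i j) l) hy
  unfold christoffelFirst
  rw [pd_const_mul (((hd i j k).fun_add (hd j i k)).fun_sub (hd k i j)),
    pd_sub ((hd i j k).fun_add (hd j i k)) (hd k i j), pd_add (hd i j k) (hd j i k)]

theorem IsMetricOn.pd_pd_christoffelFirst (hG : IsMetricOn G U) (hy : y ∈ U)
    (p l k i j : Fin m) :
    pd p (pd l (christoffelFirst G k i j)) y = (1 / 2 : ℝ) * (pd p (pd l (pd i fun z => G z j k)) y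
      + pd p (pd l (pd j fun z => G z i k)) y - pd p (pd l (pd k fun z => G z i j)) y) := by
  have hs (l i j : Fin m) := contDiffOn_pd hG.isOpen (hG.smooth i j) l
  unfold christoffelFirst
  rw [pd_pd_const_mul hG.isOpen (((hs i j k).add (hs j i k)).sub (hs k i j)) hy,
    pd_pd_sub hG.isOpen ((hs i j k).add (hs j i k)) (hs k i j) hy,
    pd_pd_add hG.isOpen (hs i j k) (hs j i k) hy]

end

namespace IsNormalAt

variable {m : ℕ} {G : Coord m → Matrix (Fin m) (Fin m) ℝ} {U : Set (Coord m)}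
  {u : Coord m → ℝ} {X : Fin m → Coord m → ℝ} {y : Coord m}

theorem differentiableAt (h : IsNormalAt G U y) (hu : ContDiffOn ℝ ∞ u U) :
    DifferentiableAt ℝ u y :=
  differentiableAt_of_contDiffOn h.metric.isOpen hu h.mem

theorem christoffel_eq_zero (h : IsNormalAt G U y) (k i j : Fin m) :
    christoffel G k i j y = 0 := by
  simp [christoffel, h.pd_eq_zero]

theorem christoffelFirst_eq_zero (h : IsNormalAt G U y) (k i j : Fin m) :
    christoffelFirst G k i j y = 0 := by
  simp [christoffelFirst, h.pd_eq_zero]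

theorem pd_inv (h : IsNormalAt G U y) (i k l : Fin m) : pd i (fun z => (G z)⁻¹ k l) y = 0 := by
  have hΓ : connectionMatrix G i y = 0 := by
    ext k j
    exact h.christoffel_eq_zero k i j
  simpa [hΓ, pdMatrix] using congrFun₂ (h.metric.pdMatrix_inv h.mem i) k l

theorem sum_inv_mul (h : IsNormalAt G U y) (x : Fin m → ℝ) (k : Fin m) :
    ∑ l, (G y)⁻¹ k l * x l = x k := by
  simp [h.eq_one, Matrix.one_apply]

theorem pd_sum_inv_mul (h : IsNormalAt G U y) (hX : ∀ l, ContDiffOn ℝ ∞ (X l) U)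
    (i k : Fin m) : pd i (fun z => ∑ l, (G z)⁻¹ k l * X l z) y = pd i (X k) y :=
  pd_sum_mul_of_eq_one (fun k l => h.differentiableAt (h.metric.contDiffOn_inv k l))
    (fun l => h.differentiableAt (hX l)) (by rw [h.eq_one, inv_one]) (h.pd_inv i) k

theorem pd_pd_sum_inv_mul (h : IsNormalAt G U y) (hX : ∀ l, ContDiffOn ℝ ∞ (X l) U)
    (hX0 : ∀ l, X l y = 0) (i j k : Fin m) :
    pd i (pd j fun z => ∑ l, (G z)⁻¹ k l * X l z) y = pd i (pd j (X k)) y := by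
  have hU := h.metric.isOpen
  have hI := h.metric.contDiffOn_inv k
  rw [pd_pd_sum hU (fun l _ => (hI l).mul (hX l)) h.mem,
    ← h.sum_inv_mul (fun l => pd i (pd j (X l)) y)]
  exact Finset.sum_congr rfl fun l _ => by
    rw [pd_pd_mul hU (hI l) (hX l) h.mem, hX0, h.pd_inv, h.pd_inv]
    ring

theorem pd_christoffel (h : IsNormalAt G U y) (l k i j : Fin m) :
    pd l (christoffel G k i j) y = (1 / 2 : ℝ) * (pd l (pd i fun z => G z j k) y
      + pd l (pd j fun z => G z i k) y - pd l (pd k fun z => G z i j) y) := by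
  rw [funext (christoffel_eq_sum G k i j),
    h.pd_sum_inv_mul fun a => h.metric.contDiffOn_christoffelFirst a i j,
    h.metric.pd_christoffelFirst h.mem]

theorem pd_pd_christoffel (h : IsNormalAt G U y) (p l k i j : Fin m) :
    pd p (pd l (christoffel G k i j)) y = (1 / 2 : ℝ) * (pd p (pd l (pd i fun z => G z j k)) y
      + pd p (pd l (pd j fun z => G z i k)) y - pd p (pd l (pd k fun z => G z i j)) y) := by
  rw [funext (christoffel_eq_sum G k i j),
    h.pd_pd_sum_inv_mul (fun a => h.metric.contDiffOn_christoffelFirst a i j)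
      fun a => h.christoffelFirst_eq_zero a i j,
    h.metric.pd_pd_christoffelFirst h.mem]

theorem ricci_apply (h : IsNormalAt G U y) (i j : Fin m) :
    ricci G i j y = ∑ k, (pd k (christoffel G k i j) y - pd j (christoffel G k i k) y) := by
  simp [ricci, h.christoffel_eq_zero]

theorem pd_ricci (h : IsNormalAt G U y) (l i j : Fin m) :
    pd l (ricci G i j) y
      = ∑ k, (pd l (pd k (christoffel G k i j)) y - pd l (pd j (christoffel G k i k)) y) := by
  have hΓ k i j := h.differentiableAt (h.metric.contDiffOn_christoffel k i j)
  have hdΓ l k i j := h.differentiableAt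
    (contDiffOn_pd h.metric.isOpen (h.metric.contDiffOn_christoffel k i j) l)
  have hlin k := (hdΓ k k i j).fun_sub (hdΓ j k i k)
  have hquad k q := ((hΓ k k q).fun_mul (hΓ q i j)).fun_sub ((hΓ k j q).fun_mul (hΓ q i k))
  have quad_eq_zero : pd l (fun z => ∑ k, ∑ q, (christoffel G k k q z * christoffel G q i j z
      - christoffel G k j q z * christoffel G q i k z)) y = 0 := by
    rw [pd_sum fun k _ => DifferentiableAt.fun_sum fun q _ => hquad k q]
    refine Finset.sum_eq_zero fun k _ => ?_
    rw [pd_sum fun q _ => hquad k q]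
    refine Finset.sum_eq_zero fun q _ => ?_
    have hΓ0 := h.christoffel_eq_zero
    rw [pd_sub ((hΓ k k q).fun_mul (hΓ q i j)) ((hΓ k j q).fun_mul (hΓ q i k)),
      pd_mul_eq_zero (hΓ k k q) (hΓ q i j) (hΓ0 k k q) (hΓ0 q i j),
      pd_mul_eq_zero (hΓ k j q) (hΓ q i k) (hΓ0 k j q) (hΓ0 q i k), sub_zero]
  unfold ricci
  rw [pd_add (DifferentiableAt.fun_sum fun k _ => hlin k)
    (DifferentiableAt.fun_sum fun k _ => DifferentiableAt.fun_sum fun q _ => hquad k q),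
    quad_eq_zero, add_zero, pd_sum fun k _ => hlin k]
  exact Finset.sum_congr rfl fun k _ => pd_sub (hdΓ k k i j) (hdΓ j k i k) l

theorem pd_ricci_eq_third_derivatives (h : IsNormalAt G U y) (l i j : Fin m) :
    pd l (ricci G i j) y = (1 / 2 : ℝ) * ∑ k, (pd l (pd k (pd i fun z => G z j k)) y
      + pd l (pd j (pd k fun z => G z i k)) y - pd l (pd k (pd k fun z => G z i j)) y
      - pd l (pd j (pd i fun z => G z k k)) y) := by
  rw [h.pd_ricci, Finset.mul_sum]
  refine Finset.sum_congr rfl fun k _ => ?_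
  have hcomm : pd l (pd k (pd j fun z => G z i k)) y = pd l (pd j (pd k fun z => G z i k)) y :=
    pd_congr_of_eqOn h.metric.isOpen
      (fun z hz => pd_comm h.metric.isOpen (h.metric.smooth i k) hz k j) h.mem l
  rw [h.pd_pd_christoffel, h.pd_pd_christoffel, hcomm]
  ring

theorem contracted_bianchi (h : IsNormalAt G U y) (j : Fin m) :
    ∑ i, pd i (ricci G i j) y = (1 / 2 : ℝ) * ∑ i, pd j (ricci G i i) y := by
  have hU := h.metric.isOpen
  set T : Fin m → Fin m → Fin m → Fin m → Fin m → ℝ := fun p l i j k =>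
    pd p (pd l (pd i fun z => G z j k)) y
  have swap_left p l i j k : T p l i j k = T l p i j k :=
    pd_comm hU (contDiffOn_pd hU (h.metric.smooth j k) i) h.mem p l
  have swap_mid p l i j k : T p l i j k = T p i l j k :=
    pd_congr_of_eqOn hU (fun z hz => pd_comm hU (h.metric.smooth j k) hz l i) h.mem p
  have swap_right p l i j k : T p l i j k = T p l i k j :=
    pd_congr_of_eqOn hU (fun z hz =>
      pd_congr_of_eqOn hU (fun z hz => h.metric.pd_symm hz i j k) hz l) h.mem p
  have div_cancel : ∑ i, ∑ k, T i k i j k = ∑ i, ∑ k, T i k k i j := by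
    rw [Finset.sum_comm]
    exact Finset.sum_congr rfl fun i _ => Finset.sum_congr rfl fun k _ => by
      rw [swap_left, swap_right]
  have div_div : ∑ i, ∑ k, T i j k i k = ∑ i, ∑ k, T j k i i k :=
    Finset.sum_congr rfl fun i _ => Finset.sum_congr rfl fun k _ => by
      rw [swap_left, swap_mid]
  have div_div' : ∑ i, ∑ k, T j i k i k = ∑ i, ∑ k, T j k i i k :=
    Finset.sum_congr rfl fun i _ => Finset.sum_congr rfl fun k _ => swap_mid ..
  have laplace_trace : ∑ i, ∑ k, T i j i k k = ∑ i, ∑ k, T j i i k k :=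
    Finset.sum_congr rfl fun i _ => Finset.sum_congr rfl fun k _ => swap_left ..
  have trace_laplace : ∑ i, ∑ k, T j k k i i = ∑ i, ∑ k, T j i i k k := Finset.sum_comm
  simp only [h.pd_ricci_eq_third_derivatives, ← Finset.mul_sum, Finset.sum_add_distrib,
    Finset.sum_sub_distrib]
  rw [div_cancel, div_div, div_div', laplace_trace, trace_laplace]
  ring

theorem hess_apply (h : IsNormalAt G U y) (u : Coord m → ℝ) (i j : Fin m) :
    hess G u i j y = pd i (pd j u) y := by
  simp [hess, h.christoffel_eq_zero]

theorem pd_hess (h : IsNormalAt G U y) (hu : ContDiffOn ℝ ∞ u U) (l i j : Fin m) :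
    pd l (hess G u i j) y
      = pd l (pd i (pd j u)) y - ∑ k, pd l (christoffel G k i j) y * pd k u y := by
  have hU := h.metric.isOpen
  have hΓ k := h.differentiableAt (h.metric.contDiffOn_christoffel k i j)
  have hd k := h.differentiableAt (contDiffOn_pd hU hu k)
  have hdd := h.differentiableAt (contDiffOn_pd hU (contDiffOn_pd hU hu j) i)
  unfold hess
  rw [pd_sub hdd (DifferentiableAt.fun_sum fun k _ => (hΓ k).fun_mul (hd k)),
    pd_sum fun k _ => (hΓ k).fun_mul (hd k)]
  congr 1
  exact Finset.sum_congr rfl fun k _ => by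
    rw [pd_mul (hΓ k) (hd k), h.christoffel_eq_zero, zero_mul, add_zero]

theorem sum_pd_christoffel_add_ricci (h : IsNormalAt G U y) (j k : Fin m) :
    ∑ i, pd i (christoffel G k i j) y + ricci G j k y = ∑ i, pd j (christoffel G k i i) y := by
  set D : Fin m → Fin m → Fin m → Fin m → ℝ := fun l i j k => pd l (pd i fun z => G z j k) y
  have swap_left l i j k : D l i j k = D i l j k :=
    pd_comm h.metric.isOpen (h.metric.smooth j k) h.mem l i
  have swap_right l i j k : D l i j k = D l i k j :=
    pd_congr_of_eqOn h.metric.isOpen (fun z hz => h.metric.pd_symm hz i j k) h.mem l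
  have hΓ l k i j : pd l (christoffel G k i j) y
      = (1 / 2 : ℝ) * (D l i j k + D l j i k - D l k i j) := h.pd_christoffel l k i j
  rw [h.ricci_apply, ← Finset.sum_add_distrib]
  refine Finset.sum_congr rfl fun i _ => ?_
  rw [hΓ, hΓ, hΓ, hΓ, swap_left i j k i, swap_right j i k i, swap_left i k j i,
    swap_right k i j i, swap_left i j i k, swap_left i k i j,
    swap_left k j i i]
  ring

theorem sum_pd_hess (h : IsNormalAt G U y) (hu : ContDiffOn ℝ ∞ u U) (j : Fin m) :
    ∑ i, pd i (hess G u i j) y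
      = ∑ i, pd j (hess G u i i) y + ∑ k, ricci G j k y * pd k u y := by
  have hU := h.metric.isOpen
  have hcomm i : pd i (pd i (pd j u)) y = pd j (pd i (pd i u)) y := by
    rw [pd_congr_of_eqOn hU (fun z hz => pd_comm hU hu hz i j) h.mem,
      pd_comm hU (contDiffOn_pd hU hu i) h.mem]
  simp only [h.pd_hess hu, Finset.sum_sub_distrib, hcomm]
  rw [Finset.sum_comm (f := fun i k => pd i (christoffel G k i j) y * pd k u y),
    Finset.sum_comm (f := fun i k => pd j (christoffel G k i i) y * pd k u y)]
  simp only [← Finset.sum_mul, ← h.sum_pd_christoffel_add_ricci, add_mul,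
    Finset.sum_add_distrib]
  ring

theorem coordLaplacian_apply (h : IsNormalAt G U y) (u : Coord m → ℝ) :
    coordLaplacian G u y = ∑ i, hess G u i i y := by
  rw [coordLaplacian, h.eq_one]
  exact metricTrace_one _

theorem pd_coordLaplacian (h : IsNormalAt G U y) (hu : ContDiffOn ℝ ∞ u U) (j : Fin m) :
    pd j (coordLaplacian G u) y = ∑ i, pd j (hess G u i i) y := by
  unfold coordLaplacian metricTrace
  rw [pd_sum fun i _ => h.differentiableAt <| ContDiffOn.sum fun l _ =>
    (h.metric.contDiffOn_inv i l).mul (h.metric.contDiffOn_hess hu i l)]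
  exact Finset.sum_congr rfl fun i _ => h.pd_sum_inv_mul (h.metric.contDiffOn_hess hu i) j i

theorem grad_apply (h : IsNormalAt G U y) (u : Coord m → ℝ) (k : Fin m) :
    grad G u y k = pd k u y :=
  h.sum_inv_mul (fun l => pd l u y) k

theorem gradInner_apply (h : IsNormalAt G U y) (u v : Coord m → ℝ) :
    gradInner G u v y = ∑ i, pd i u y * pd i v y := by
  simp only [gradInner_eq_dotProduct, dotProduct, h.grad_apply]

theorem pd_gradInner_self (h : IsNormalAt G U y) (hu : ContDiffOn ℝ ∞ u U) (i : Fin m) :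
    pd i (gradInner G u u) y = 2 * ∑ k, hess G u i k y * pd k u y := by
  simp only [h.metric.pd_gradInner hu hu h.mem, dotProduct, h.grad_apply, two_mul]

theorem pd_pd_gradInner_self (h : IsNormalAt G U y) (hu : ContDiffOn ℝ ∞ u U) (i : Fin m) :
    pd i (pd i (gradInner G u u)) y
      = 2 * (∑ k, pd i (hess G u i k) y * pd k u y + ∑ k, hess G u i k y ^ 2) := by
  have hU := h.metric.isOpen
  have hX l := contDiffOn_pd hU hu l
  have hgrad k : ContDiffOn ℝ ∞ (fun z => grad G u z k) U := by
    simp only [grad, Matrix.mulVec, dotProduct]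
    exact ContDiffOn.sum fun l _ => (h.metric.contDiffOn_inv k l).mul (hX l)
  have hpd_grad k : pd i (fun z => grad G u z k) y = hess G u i k y :=
    (h.pd_sum_inv_mul hX i k).trans (h.hess_apply u i k).symm
  have hd k := h.differentiableAt (h.metric.contDiffOn_hess hu i k)
  have hd' k := h.differentiableAt (hgrad k)
  have hfirst : Set.EqOn (pd i (gradInner G u u))
      (fun z => 2 * ∑ k, hess G u i k z * grad G u z k) U := fun z hz => by
    simp only [h.metric.pd_gradInner hu hu hz, dotProduct, two_mul]
  rw [pd_congr_of_eqOn hU hfirst h.mem,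
    pd_const_mul (DifferentiableAt.fun_sum fun k _ => (hd k).fun_mul (hd' k)),
    pd_sum fun k _ => (hd k).fun_mul (hd' k), ← Finset.sum_add_distrib]
  congr 1
  exact Finset.sum_congr rfl fun k _ => by
    rw [pd_mul (hd k) (hd' k), hpd_grad, h.grad_apply, sq]

theorem bochner (h : IsNormalAt G U y) (hu : ContDiffOn ℝ ∞ u U) :
    ∑ i, pd i (pd i (gradInner G u u)) y
      = 2 * (∑ i, ∑ k, hess G u i k y ^ 2 + ∑ k, pd k (coordLaplacian G u) y * pd k u y
        + ∑ j, ∑ k, ricci G j k y * pd k u y * pd j u y) := by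
  simp only [h.pd_pd_gradInner_self hu, ← Finset.mul_sum, Finset.sum_add_distrib]
  rw [Finset.sum_comm (f := fun i k => pd i (hess G u i k) y * pd k u y)]
  simp only [← Finset.sum_mul, h.sum_pd_hess hu, ← h.pd_coordLaplacian hu, add_mul,
    Finset.sum_add_distrib]
  ring

end IsNormalAt

/-! ### The soliton equations in coordinates -/

section

variable {m n : ℕ} {G : Coord m → Matrix (Fin m) (Fin m) ℝ} {U : Set (Coord m)}
  {H : Coord n → Matrix (Fin n) (Fin n) ℝ} {U' : Set (Coord n)} {Φ : Coord m → Coord n}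
  {f : Coord m → ℝ} {y : Coord m} {α lam : ℝ}

theorem coordPullback_apply (z : Coord m) (i j : Fin m) :
    coordPullback H Φ z i j = ∑ a, ∑ b, H (Φ z) a b * (jac Φ z a i * jac Φ z b j) := by
  rw [coordPullback, Matrix.mul_assoc]
  simp only [Matrix.mul_apply, Matrix.transpose_apply, Finset.mul_sum]
  exact Finset.sum_congr rfl fun a _ => Finset.sum_congr rfl fun b _ => by ring

theorem contDiffOn_jac (hU : IsOpen U) (hΦ : ContDiffOn ℝ ∞ Φ U) (a : Fin n) (i : Fin m) :
    ContDiffOn ℝ ∞ (fun z => jac Φ z a i) U :=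
  contDiffOn_pd hU (contDiffOn_coord hΦ a) i

theorem contDiffOn_coordPullback (hU : IsOpen U) (hH : IsMetricOn H U')
    (hΦ : ContDiffOn ℝ ∞ Φ U) (hmaps : Set.MapsTo Φ U U') (i j : Fin m) :
    ContDiffOn ℝ ∞ (fun z => coordPullback H Φ z i j) U := by
  simp only [coordPullback_apply]
  exact ContDiffOn.sum fun a _ => ContDiffOn.sum fun b _ => ((hH.smooth a b).comp hΦ hmaps).mul
    ((contDiffOn_jac hU hΦ a i).mul (contDiffOn_jac hU hΦ b j))

theorem IsNormalAt.coordPullback_eq (hH : IsNormalAt H U' (Φ y)) :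
    coordPullback H Φ y = (jac Φ y).transpose * jac Φ y := by
  rw [coordPullback, hH.eq_one, Matrix.mul_one]

theorem IsNormalAt.pd_coordPullback (hH : IsNormalAt H U' (Φ y)) (hU : IsOpen U) (hy : y ∈ U)
    (hΦ : ContDiffOn ℝ ∞ Φ U) (l i j : Fin m) :
    pd l (fun z => coordPullback H Φ z i j) y
      = ∑ a, (pd l (fun z => jac Φ z a i) y * jac Φ y a j
        + jac Φ y a i * pd l (fun z => jac Φ z a j) y) := by
  have hΦd : DifferentiableAt ℝ Φ y :=
    (hΦ.contDiffAt (hU.mem_nhds hy)).differentiableAt (by simp)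
  have hJ a i := differentiableAt_of_contDiffOn hU (contDiffOn_jac hU hΦ a i) hy
  have hd a b := hH.differentiableAt (hH.metric.smooth a b)
  have hHΦ a b : DifferentiableAt ℝ (fun x => H (Φ x) a b) y := (hd a b).comp y hΦd
  have hHΦ0 a b : pd l (fun x => H (Φ x) a b) y = 0 := by
    rw [pd_comp (u := fun x => H x a b) hΦd (hd a b)]
    simp [hH.pd_eq_zero]
  simp only [coordPullback_apply]
  rw [pd_sum fun a _ => DifferentiableAt.fun_sum fun b _ =>
    (hHΦ a b).fun_mul ((hJ a i).fun_mul (hJ b j))]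
  refine Finset.sum_congr rfl fun a _ => ?_
  rw [pd_sum_mul_of_eq_one hHΦ (fun b => (hJ a i).fun_mul (hJ b j)) hH.eq_one hHΦ0,
    pd_mul (hJ a i) (hJ a j)]

theorem IsNormalAt.tension_apply (hG : IsNormalAt G U y) (hH : IsNormalAt H U' (Φ y))
    (a : Fin n) : tension G H Φ a y = ∑ i, pd i (fun z => jac Φ z a i) y := by
  rw [tension, hG.eq_one]
  refine (metricTrace_one _).trans (Finset.sum_congr rfl fun i _ => ?_)
  simp only [hG.hess_apply, hH.christoffel_eq_zero, zero_mul,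
    Finset.sum_const_zero, add_zero]
  rfl

theorem IsNormalAt.sum_pd_coordPullback (hG : IsNormalAt G U y) (hH : IsNormalAt H U' (Φ y))
    (hΦ : ContDiffOn ℝ ∞ Φ U) (j : Fin m) :
    ∑ i, pd i (fun z => coordPullback H Φ z i j) y
      = (1 / 2 : ℝ) * ∑ i, pd j (fun z => coordPullback H Φ z i i) y
        + ∑ a, tension G H Φ a y * jac Φ y a j := by
  have hU := hG.metric.isOpen
  have pd_jac_comm a i : pd j (fun z => jac Φ z a i) y = pd i (fun z => jac Φ z a j) y :=
    pd_comm hU (contDiffOn_coord hΦ a) hG.mem j i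
  simp only [hH.pd_coordPullback hU hG.mem hΦ, hG.tension_apply hH, Finset.sum_mul]
  rw [Finset.sum_comm (s := Finset.univ (α := Fin n)), Finset.mul_sum, ← Finset.sum_add_distrib]
  refine Finset.sum_congr rfl fun i _ => ?_
  rw [Finset.mul_sum, ← Finset.sum_add_distrib]
  refine Finset.sum_congr rfl fun a _ => ?_
  rw [pd_jac_comm a i]
  ring

end

/-- The soliton equations for a map `Φ` and a potential `f` in coordinate domains `U` and `U'`
with metrics `G` and `H`. -/
structure IsCoordSoliton {m n : ℕ} (G : Coord m → Matrix (Fin m) (Fin m) ℝ)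
    (H : Coord n → Matrix (Fin n) (Fin n) ℝ) (Φ : Coord m → Coord n) (f : Coord m → ℝ)
    (α lam : ℝ) (U : Set (Coord m)) (U' : Set (Coord n)) : Prop where
  contDiffOn_map : ContDiffOn ℝ ∞ Φ U
  mapsTo : Set.MapsTo Φ U U'
  contDiffOn_potential : ContDiffOn ℝ ∞ f U
  soliton : ∀ z ∈ U, ∀ i j,
    ricci G i j z - α * coordPullback H Φ z i j + hess G f i j z = lam * G z i j
  map_eq : ∀ z ∈ U, ∀ a, tension G H Φ a z = gradInner G (fun x => Φ x a) f z

namespace IsCoordSoliton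

variable {m n : ℕ} {G : Coord m → Matrix (Fin m) (Fin m) ℝ} {U : Set (Coord m)}
  {H : Coord n → Matrix (Fin n) (Fin n) ℝ} {U' : Set (Coord n)} {Φ : Coord m → Coord n}
  {f : Coord m → ℝ} {y : Coord m} {α lam : ℝ}

theorem pd_soliton (h : IsCoordSoliton G H Φ f α lam U U') (hG : IsNormalAt G U y)
    (hH : IsMetricOn H U') (l i j : Fin m) :
    pd l (ricci G i j) y - α * pd l (fun z => coordPullback H Φ z i j) y
      + pd l (hess G f i j) y = 0 := by
  have hU := hG.metric.isOpen
  have hRic := hG.differentiableAt (hG.metric.contDiffOn_ricci i j)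
  have hP := hG.differentiableAt (contDiffOn_coordPullback hU hH h.contDiffOn_map h.mapsTo i j)
  have hHess := hG.differentiableAt (hG.metric.contDiffOn_hess h.contDiffOn_potential i j)
  have hpd := pd_congr_of_eqOn hU (fun z hz => h.soliton z hz i j) hG.mem l
  rwa [pd_add (hRic.fun_sub (hP.const_mul α)) hHess, pd_sub hRic (hP.const_mul α),
    pd_const_mul hP, pd_const_mul (hG.differentiableAt (hG.metric.smooth i j)), hG.pd_eq_zero,
    mul_zero] at hpd

theorem sum_pd_hess (h : IsCoordSoliton G H Φ f α lam U U') (hG : IsNormalAt G U y)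
    (hH : IsNormalAt H U' (Φ y)) (j : Fin m) :
    ∑ i, pd i (hess G f i j) y = (1 / 2 : ℝ) * pd j (coordLaplacian G f) y
      + α * ∑ a, tension G H Φ a y * jac Φ y a j := by
  have hdiv : ∑ i, (pd i (ricci G i j) y - α * pd i (fun z => coordPullback H Φ z i j) y
      + pd i (hess G f i j) y) = 0 :=
    Finset.sum_eq_zero fun i _ => h.pd_soliton hG hH.metric i i j
  have htrace : ∑ i, (pd j (ricci G i i) y - α * pd j (fun z => coordPullback H Φ z i i) y
      + pd j (hess G f i i) y) = 0 :=
    Finset.sum_eq_zero fun i _ => h.pd_soliton hG hH.metric j i i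
  simp only [Finset.sum_add_distrib, Finset.sum_sub_distrib, ← Finset.mul_sum] at hdiv htrace
  rw [hG.contracted_bianchi, hG.sum_pd_coordPullback hH h.contDiffOn_map] at hdiv
  rw [hG.pd_coordLaplacian h.contDiffOn_potential]
  linarith

theorem tension_eq (h : IsCoordSoliton G H Φ f α lam U U') (hG : IsNormalAt G U y) :
    (fun a => tension G H Φ a y) = (jac Φ y).mulVec fun k => pd k f y := by
  ext a
  rw [h.map_eq y hG.mem, hG.gradInner_apply]
  rfl

theorem sum_tension_mul_jac (h : IsCoordSoliton G H Φ f α lam U U') (hG : IsNormalAt G U y)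
    (hH : IsNormalAt H U' (Φ y)) (j : Fin m) :
    ∑ a, tension G H Φ a y * jac Φ y a j = ∑ k, coordPullback H Φ y j k * pd k f y := by
  have hvec : (jac Φ y).transpose.mulVec (fun a => tension G H Φ a y)
      = (coordPullback H Φ y).mulVec fun k => pd k f y := by
    rw [h.tension_eq hG, Matrix.mulVec_mulVec, hH.coordPullback_eq]
  simpa only [Matrix.mulVec, dotProduct, Matrix.transpose_apply, mul_comm] using congrFun hvec j

theorem sum_ricci_mul_pd (h : IsCoordSoliton G H Φ f α lam U U') (hG : IsNormalAt G U y)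
    (j : Fin m) :
    ∑ k, ricci G j k y * pd k f y - α * ∑ k, coordPullback H Φ y j k * pd k f y
      + ∑ k, hess G f j k y * pd k f y = lam * pd j f y := by
  have hterm k : ricci G j k y * pd k f y - α * (coordPullback H Φ y j k * pd k f y)
      + hess G f j k y * pd k f y = lam * ((1 : Matrix (Fin m) (Fin m) ℝ) j k * pd k f y) := by
    rw [← mul_assoc lam, ← hG.eq_one, ← h.soliton y hG.mem j k]
    ring
  rw [Finset.mul_sum, ← Finset.sum_sub_distrib, ← Finset.sum_add_distrib,
    Finset.sum_congr rfl fun k _ => hterm k, ← Finset.mul_sum]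
  simp [Matrix.one_apply]

/-- Compare the two expressions for `div Hess f`, one from the contracted Bianchi identity and the
soliton equation, the other from commuting derivatives. -/
theorem pd_coordLaplacian_eq (h : IsCoordSoliton G H Φ f α lam U U') (hG : IsNormalAt G U y)
    (hH : IsNormalAt H U' (Φ y)) (j : Fin m) :
    pd j (coordLaplacian G f) y = pd j (gradInner G f f) y - 2 * lam * pd j f y := by
  have hdiv := h.sum_pd_hess hG hH j
  rw [hG.sum_pd_hess h.contDiffOn_potential, ← hG.pd_coordLaplacian h.contDiffOn_potential,
    h.sum_tension_mul_jac hG hH] at hdiv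
  rw [hG.pd_gradInner_self h.contDiffOn_potential]
  linarith [h.sum_ricci_mul_pd hG j]

theorem sum_ricci_grad_grad_of_critical (h : IsCoordSoliton G H Φ f α lam U U')
    (hG : IsNormalAt G U y) (hH : IsNormalAt H U' (Φ y))
    (hcrit : ∀ j, pd j (coordLaplacian G f) y = 0) :
    ∑ j, ∑ k, ricci G j k y * pd k f y * pd j f y = α * ∑ a, tension G H Φ a y ^ 2 := by
  have hric j : ∑ k, ricci G j k y * pd k f y = α * ∑ a, tension G H Φ a y * jac Φ y a j := by
    have hgrad := h.pd_coordLaplacian_eq hG hH j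
    rw [hcrit, hG.pd_gradInner_self h.contDiffOn_potential] at hgrad
    rw [h.sum_tension_mul_jac hG hH]
    linarith [h.sum_ricci_mul_pd hG j]
  simp only [← Finset.sum_mul, hric]
  simp only [mul_assoc α, ← Finset.mul_sum]
  congr 1
  simp only [Finset.sum_mul]
  rw [Finset.sum_comm]
  refine Finset.sum_congr rfl fun a _ => ?_
  simp only [mul_assoc, ← Finset.mul_sum, sq]
  exact congrArg _ (congrFun (h.tension_eq hG) a).symm

theorem sum_sq_hess_le (h : IsCoordSoliton G H Φ f α lam U U') (hG : IsNormalAt G U y)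
    (hH : IsNormalAt H U' (Φ y)) (hα : 0 ≤ α)
    (hpd : ∀ z ∈ U, ∀ j, pd j (coordLaplacian G f) z = pd j (gradInner G f f) z
      - 2 * lam * pd j f z)
    (hcrit : ∀ j, pd j (coordLaplacian G f) y = 0)
    (hmax : ∀ i, pd i (pd i (coordLaplacian G f)) y ≤ 0) :
    ∑ i, ∑ k, hess G f i k y ^ 2 ≤ lam * coordLaplacian G f y := by
  have hf := h.contDiffOn_potential
  have hU := hG.metric.isOpen
  have hpdpd i : pd i (pd i (coordLaplacian G f)) y
      = pd i (pd i (gradInner G f f)) y - 2 * lam * hess G f i i y := by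
    have hdf := hG.differentiableAt (contDiffOn_pd hU hf i)
    rw [pd_congr_of_eqOn hU (fun z hz => hpd z hz i) hG.mem, pd_sub (hG.differentiableAt
      (contDiffOn_pd hU (hG.metric.contDiffOn_gradInner hf hf) i)) (hdf.const_mul _),
      pd_const_mul hdf, hG.hess_apply]
  have hsum := Finset.sum_nonpos fun i (_ : i ∈ Finset.univ) => hmax i
  simp only [hpdpd, Finset.sum_sub_distrib, ← Finset.mul_sum, ← hG.coordLaplacian_apply] at hsum
  rw [hG.bochner hf, h.sum_ricci_grad_grad_of_critical hG hH hcrit] at hsum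
  simp only [hcrit, zero_mul, Finset.sum_const_zero] at hsum
  have htension : 0 ≤ α * ∑ a, tension G H Φ a y ^ 2 :=
    mul_nonneg hα (Finset.sum_nonneg fun a _ => sq_nonneg _)
  linarith

theorem coordLaplacian_le (h : IsCoordSoliton G H Φ f α lam U U') (hG : IsNormalAt G U y)
    (hH : IsNormalAt H U' (Φ y)) (hα : 0 ≤ α) (hlam : 0 < lam)
    (hpd : ∀ z ∈ U, ∀ j, pd j (coordLaplacian G f) z = pd j (gradInner G f f) z
      - 2 * lam * pd j f z)
    (hcrit : ∀ j, pd j (coordLaplacian G f) y = 0)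
    (hmax : ∀ i, pd i (pd i (coordLaplacian G f)) y ≤ 0) :
    coordLaplacian G f y ≤ m * lam := by
  have hhess := h.sum_sq_hess_le hG hH hα hpd hcrit hmax
  have hdiag : ∑ i, hess G f i i y ^ 2 ≤ ∑ i, ∑ k, hess G f i k y ^ 2 :=
    Finset.sum_le_sum fun i _ => Finset.single_le_sum (f := fun k => hess G f i k y ^ 2)
      (fun k _ => sq_nonneg _) (Finset.mem_univ i)
  have hsq : coordLaplacian G f y ^ 2 ≤ m * (lam * coordLaplacian G f y) :=
    calc coordLaplacian G f y ^ 2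
        ≤ m * ∑ i, hess G f i i y ^ 2 := by
          simpa [hG.coordLaplacian_apply] using
            sq_sum_le_card_mul_sum_sq (s := Finset.univ) (f := fun i => hess G f i i y)
      _ ≤ m * (lam * coordLaplacian G f y) := by gcongr; exact hdiag.trans hhess
  rcases le_or_gt (coordLaplacian G f y) 0 with hle | hpos
  · exact hle.trans (by positivity)
  · exact le_of_mul_le_mul_right (by linarith) hpos

end IsCoordSoliton

/-! ### Metrics and maps in the charts of a manifold -/

section

variable {m n : ℕ} {M : Type*} [TopologicalSpace M] {N : Type*} [TopologicalSpace N]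
  {e e₁ : OpenPartialHomeomorph M (Coord m)} {e' : OpenPartialHomeomorph N (Coord n)}
  {φ : M → N} {z : Coord m}

theorem isOpen_chart_map (e : OpenPartialHomeomorph M (Coord m))
    (e' : OpenPartialHomeomorph N (Coord n)) (hφ : Continuous φ) :
    IsOpen (e.target ∩ (fun z => φ (e.symm z)) ⁻¹' e'.source) :=
  (hφ.comp_continuousOn e.continuousOn_symm).isOpen_inter_preimage e.open_target e'.open_source

theorem fderiv_single {Φ : Coord m → Coord n} (hΦ : DifferentiableAt ℝ Φ z) (i : Fin m) :
    fderiv ℝ Φ z (EuclideanSpace.single i (1 : ℝ))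
      = ∑ a, jac Φ z a i • (EuclideanSpace.single a (1 : ℝ) : Coord n) := by
  ext b
  simp [jac_apply hΦ, Pi.single_apply]

variable [ChartedSpace (Coord m) M] [ChartedSpace (Coord n) N]

/-- The differential of a map between manifolds as a linear map between the model spaces. The
tangent spaces are definitionally the model spaces, but stating this once and for all keeps the
dependent types out of the computations. -/
noncomputable def modelDeriv (m n : ℕ) {M N : Type*} [TopologicalSpace M]
    [ChartedSpace (Coord m) M] [TopologicalSpace N] [ChartedSpace (Coord n) N] (φ : M → N)
    (p : M) : Coord m →L[ℝ] Coord n :=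
  mfderiv (𝓡 m) (𝓡 n) φ p

theorem contDiffOn_comp_symm (he : e ∈ IsManifold.maximalAtlas (𝓡 m) ∞ M) {u : M → ℝ}
    (hu : ContMDiff (𝓡 m) 𝓘(ℝ, ℝ) ∞ u) : ContDiffOn ℝ ∞ (fun z => u (e.symm z)) e.target :=
  contMDiffOn_iff_contDiffOn.1 (hu.comp_contMDiffOn (contMDiffOn_symm_of_mem_maximalAtlas he))

theorem contDiffOn_chart_map (he : e ∈ IsManifold.maximalAtlas (𝓡 m) ∞ M)
    (he' : e' ∈ IsManifold.maximalAtlas (𝓡 n) ∞ N) (hφ : ContMDiff (𝓡 m) (𝓡 n) ∞ φ) :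
    ContDiffOn ℝ ∞ (fun z => e' (φ (e.symm z)))
      (e.target ∩ (fun z => φ (e.symm z)) ⁻¹' e'.source) :=
  contMDiffOn_iff_contDiffOn.1 <| (contMDiffOn_of_mem_maximalAtlas he').comp
    ((hφ.comp_contMDiffOn (contMDiffOn_symm_of_mem_maximalAtlas he)).mono Set.inter_subset_left)
    Set.inter_subset_right

theorem modelDeriv_comp_symm (he : e ∈ IsManifold.maximalAtlas (𝓡 m) ∞ M)
    (he' : e' ∈ IsManifold.maximalAtlas (𝓡 n) ∞ N) (hφ : ContMDiff (𝓡 m) (𝓡 n) ∞ φ)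
    (hz : z ∈ e.target ∩ (fun z => φ (e.symm z)) ⁻¹' e'.source) :
    (modelDeriv m n φ (e.symm z)).comp (modelDeriv m m e.symm z)
      = (modelDeriv n n e'.symm (e' (φ (e.symm z)))).comp
          (fderiv ℝ (fun x => e' (φ (e.symm x))) z) := by
  have hV := (isOpen_chart_map e e' hφ.continuous).mem_nhds hz
  have hφe : modelDeriv m n (φ ∘ e.symm) z
      = (modelDeriv m n φ (e.symm z)).comp (modelDeriv m m e.symm z) :=
    mfderiv_comp z (hφ.mdifferentiable (by simp) _)
      ((contMDiffAt_symm_of_mem_maximalAtlas he hz.1).mdifferentiableAt (by simp))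
  have heq : φ ∘ e.symm =ᶠ[nhds z] e'.symm ∘ fun x => e' (φ (e.symm x)) :=
    Filter.eventually_of_mem hV fun x hx => (e'.left_inv hx.2).symm
  have hchain := mfderiv_comp z
    ((contMDiffAt_symm_of_mem_maximalAtlas he' (e'.map_source hz.2)).mdifferentiableAt (by simp))
    (((contDiffOn_chart_map he he' hφ).contDiffAt hV).differentiableAt
      (by simp)).mdifferentiableAt
  rw [mfderiv_eq_fderiv] at hchain
  exact hφe.symm.trans (heq.mfderiv_eq.trans hchain)

theorem modelDeriv_symm_single (he : e ∈ IsManifold.maximalAtlas (𝓡 m) ∞ M)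
    (he' : e' ∈ IsManifold.maximalAtlas (𝓡 n) ∞ N) (hφ : ContMDiff (𝓡 m) (𝓡 n) ∞ φ)
    (hz : z ∈ e.target ∩ (fun z => φ (e.symm z)) ⁻¹' e'.source) (i : Fin m) :
    modelDeriv m n φ (e.symm z) (modelDeriv m m e.symm z (EuclideanSpace.single i 1))
      = ∑ a, jac (fun x => e' (φ (e.symm x))) z a i •
          modelDeriv n n e'.symm (e' (φ (e.symm z))) (EuclideanSpace.single a 1) := by
  have hΦ : DifferentiableAt ℝ (fun x => e' (φ (e.symm x))) z :=
    ((contDiffOn_chart_map he he' hφ).contDiffAt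
      ((isOpen_chart_map e e' hφ.continuous).mem_nhds hz)).differentiableAt (by simp)
  rw [← ContinuousLinearMap.comp_apply, modelDeriv_comp_symm he he' hφ hz,
    ContinuousLinearMap.comp_apply, fderiv_single hΦ, map_sum]
  simp only [map_smul]

variable [IsManifold (𝓡 n) ∞ N]

/-- The metric at `q` as a bilinear form on the model space. -/
noncomputable def innerAt (h : RiemMetric n N) (q : N) : Coord n →L[ℝ] Coord n →L[ℝ] ℝ :=
  h.inner q

theorem innerAt_sum (h : RiemMetric n N) (q : N) {ι : Type*} [Fintype ι] (c d : ι → ℝ)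
    (v w : ι → Coord n) :
    innerAt h q (∑ a, c a • v a) (∑ b, d b • w b)
      = ∑ a, ∑ b, innerAt h q (v a) (w b) * (c a * d b) := by
  simp only [map_sum, map_smul, sum_apply, smul_apply, smul_eq_mul, Finset.mul_sum]
  rw [Finset.sum_comm]
  exact Finset.sum_congr rfl fun a _ => Finset.sum_congr rfl fun b _ => by ring

theorem gram_apply (h : RiemMetric n N) (e' : OpenPartialHomeomorph N (Coord n)) (z : Coord n)
    (i j : Fin n) : gram h e' z i j = innerAt h (e'.symm z)
      (modelDeriv n n e'.symm z (EuclideanSpace.single i 1))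
      (modelDeriv n n e'.symm z (EuclideanSpace.single j 1)) := rfl

theorem pullback_eq_coordPullback (he : e ∈ IsManifold.maximalAtlas (𝓡 m) ∞ M)
    (he' : e' ∈ IsManifold.maximalAtlas (𝓡 n) ∞ N) (h : RiemMetric n N)
    (hφ : ContMDiff (𝓡 m) (𝓡 n) ∞ φ)
    (hz : z ∈ e.target ∩ (fun z => φ (e.symm z)) ⁻¹' e'.source) :
    pullback h φ e z = coordPullback (gram h e') (fun x => e' (φ (e.symm x))) z := by
  ext i j
  change innerAt h (φ (e.symm z))
    (modelDeriv m n φ (e.symm z) (modelDeriv m m e.symm z (EuclideanSpace.single i 1)))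
    (modelDeriv m n φ (e.symm z) (modelDeriv m m e.symm z (EuclideanSpace.single j 1))) = _
  rw [modelDeriv_symm_single he he' hφ hz, modelDeriv_symm_single he he' hφ hz, innerAt_sum,
    coordPullback_apply]
  simp only [gram_apply, e'.left_inv hz.2]

variable [IsManifold (𝓡 m) ∞ M]

theorem gram_eq_pullback_id (g : RiemMetric m M) (e : OpenPartialHomeomorph M (Coord m))
    (z : Coord m) : gram g e z = pullback g id e z := by
  ext i j
  simp only [pullback, mfderiv_id]
  rfl

theorem contMDiffOn_coordVec (he : e ∈ IsManifold.maximalAtlas (𝓡 m) ∞ M) (i : Fin m) :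
    ContMDiffOn (𝓡 m) ((𝓡 m).prod (𝓡 m)) ∞
      (fun z => TotalSpace.mk' (Coord m) (E := fun p : M => TangentSpace (𝓡 m) p) (e.symm z)
        (coordVec e z i)) e.target := by
  have hconst : ContMDiff (𝓡 m) ((𝓡 m).prod (𝓡 m)) ∞ fun z : Coord m =>
      TotalSpace.mk' (Coord m) (E := fun p : Coord m => TangentSpace (𝓡 m) p) z
        (EuclideanSpace.single i (1 : ℝ) : Coord m) :=
    contMDiff_vectorSpace_iff_contDiff.2 contDiff_const
  have htangent := (contMDiffOn_symm_of_mem_maximalAtlas he).contMDiffOn_tangentMapWithin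
    (m := ∞) (by simp) e.open_target.uniqueMDiffOn
  refine (htangent.comp hconst.contMDiffOn fun z hz => hz).congr fun z hz => ?_
  simp only [Function.comp, tangentMapWithin]
  rw [mfderivWithin_of_isOpen e.open_target hz]
  rfl

theorem contDiffOn_gram (he : e ∈ IsManifold.maximalAtlas (𝓡 m) ∞ M) (g : RiemMetric m M)
    (i j : Fin m) : ContDiffOn ℝ ∞ (fun z => gram g e z i j) e.target := by
  have hbundle : ContMDiffOn (𝓡 m) ((𝓡 m).prod 𝓘(ℝ, ℝ)) ∞
      (fun z => TotalSpace.mk' ℝ (E := Bundle.Trivial M ℝ) (e.symm z)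
        (g.inner (e.symm z) (coordVec e z i) (coordVec e z j))) e.target :=
    ContMDiffOn.clm_bundle_apply₂ (F₁ := Coord m) (F₂ := Coord m)
      (g.contMDiff.comp_contMDiffOn (contMDiffOn_symm_of_mem_maximalAtlas he))
      (contMDiffOn_coordVec he i) (contMDiffOn_coordVec he j)
  intro z hz
  have hz' := hbundle z hz
  simp only [contMDiffWithinAt_totalSpace] at hz'
  exact contMDiffWithinAt_iff_contDiffWithinAt.1 hz'.2

theorem dotProduct_gram_mulVec (g : RiemMetric m M) (e : OpenPartialHomeomorph M (Coord m))
    (z : Coord m) (x : Fin m → ℝ) :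
    x ⬝ᵥ (gram g e z).mulVec x = innerAt g (e.symm z) (modelDeriv m m e.symm z (WithLp.toLp 2 x))
      (modelDeriv m m e.symm z (WithLp.toLp 2 x)) := by
  have hx : WithLp.toLp 2 x = ∑ a, x a • (EuclideanSpace.single a (1 : ℝ) : Coord m) := by
    ext j
    simp [Pi.single_apply]
  simp only [hx, map_sum (modelDeriv m m e.symm z), map_smul (modelDeriv m m e.symm z),
    innerAt_sum, dotProduct, Matrix.mulVec, Finset.mul_sum, gram_apply]
  exact Finset.sum_congr rfl fun a _ => Finset.sum_congr rfl fun b _ => by ring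

theorem posDef_gram (he : e ∈ IsManifold.maximalAtlas (𝓡 m) ∞ M) (g : RiemMetric m M)
    (hz : z ∈ e.target) : (gram g e z).PosDef := by
  have hdiff : e.MDifferentiable (𝓡 m) (𝓡 m) :=
    ⟨(contMDiffOn_of_mem_maximalAtlas he).mdifferentiableOn (by simp),
      (contMDiffOn_symm_of_mem_maximalAtlas he).mdifferentiableOn (by simp)⟩
  have hinj : Function.Injective (modelDeriv m m e.symm z) := hdiff.symm.mfderiv_injective hz
  refine Matrix.PosDef.of_dotProduct_mulVec_pos ?_ fun x hx => ?_
  · ext i j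
    simpa [gram] using g.symm _ _ _
  · rw [star_trivial, dotProduct_gram_mulVec]
    refine g.pos _ _ fun hzero => hx ?_
    exact WithLp.toLp_injective 2 (hinj (Eq.trans hzero (map_zero _).symm))

theorem isMetricOn_gram (he : e ∈ IsManifold.maximalAtlas (𝓡 m) ∞ M) (g : RiemMetric m M) :
    IsMetricOn (gram g e) e.target where
  isOpen := e.open_target
  smooth := contDiffOn_gram he g
  posDef _ := posDef_gram he g

theorem isIsometryOn_gram (he : e ∈ IsManifold.maximalAtlas (𝓡 m) ∞ M)
    (he₁ : e₁ ∈ IsManifold.maximalAtlas (𝓡 m) ∞ M) (g : RiemMetric m M) :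
    IsIsometryOn (fun z => e₁ (e.symm z)) (gram g e) (gram g e₁)
      (e.target ∩ e.symm ⁻¹' e₁.source) e₁.target where
  source := (isMetricOn_gram he g).mono (isOpen_chart_map (φ := id) e e₁ continuous_id)
    Set.inter_subset_left
  target := isMetricOn_gram he₁ g
  contDiffOn := contDiffOn_chart_map he he₁ contMDiff_id
  mapsTo _ hz := e₁.map_source hz.2
  pullback_eq z hz := by
    rw [gram_eq_pullback_id, pullback_eq_coordPullback he he₁ g contMDiff_id hz]
    rfl

end

/-! ### Normal charts -/

section

variable {m : ℕ} {M : Type*} [TopologicalSpace M] [ChartedSpace (Coord m) M]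
  {U V : Set (Coord m)} {G G' : Coord m → Matrix (Fin m) (Fin m) ℝ} {ψ : Coord m → Coord m}
  {y : Coord m}

theorem exists_hasFDerivAt_equiv (hψ : DifferentiableAt ℝ ψ y) (hdet : IsUnit (jac ψ y).det) :
    ∃ L : Coord m ≃L[ℝ] Coord m, HasFDerivAt ψ (L : Coord m →L[ℝ] Coord m) y := by
  have hinj : Function.Injective (fderiv ℝ ψ y : Coord m →ₗ[ℝ] Coord m) := by
    rw [← toLpLin_jac hψ]
    exact fun v w hvw => WithLp.ofLp_injective 2 <| Matrix.mulVec_injective_of_isUnit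
      ((Matrix.isUnit_iff_isUnit_det _).2 hdet) (WithLp.toLp_injective 2 hvw)
  exact ⟨(LinearEquiv.ofInjectiveEndo _ hinj).toContinuousLinearEquiv, hψ.hasFDerivAt⟩

theorem exists_openPartialHomeomorph_of_contDiff (hψ : ContDiff ℝ ∞ ψ)
    (hdet : IsUnit (jac ψ y).det) :
    ∃ P : OpenPartialHomeomorph (Coord m) (Coord m), (P : Coord m → Coord m) = ψ ∧
      y ∈ P.source ∧ ContDiffOn ℝ ∞ P.symm P.target := by
  have hdiff := hψ.differentiable (by simp)
  obtain ⟨L, hL⟩ := exists_hasFDerivAt_equiv (hdiff y) hdet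
  have hopen : IsOpen {x | (jac ψ x).det ≠ 0} := by
    have hcont := (contDiffOn_det fun a i =>
      contDiffOn_jac isOpen_univ hψ.contDiffOn a i).continuousOn
    exact isOpen_ne.preimage (continuousOn_univ.1 hcont)
  refine ⟨(hψ.contDiffAt.toOpenPartialHomeomorph ψ hL (by simp)).restrOpen _ hopen, rfl,
    ⟨hψ.contDiffAt.mem_toOpenPartialHomeomorph_source hL (by simp), hdet.ne_zero⟩,
    fun x hx => ?_⟩
  obtain ⟨L', hL'⟩ := exists_hasFDerivAt_equiv (hdiff _)
    (Ne.isUnit (OpenPartialHomeomorph.map_target _ hx).2)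
  exact (OpenPartialHomeomorph.contDiffAt_symm _ hx hL' hψ.contDiffAt).contDiffWithinAt

theorem trans_mem_maximalAtlas [IsManifold (𝓡 m) ∞ M] {e : OpenPartialHomeomorph M (Coord m)}
    (he : e ∈ IsManifold.maximalAtlas (𝓡 m) ∞ M)
    {P : OpenPartialHomeomorph (Coord m) (Coord m)} (hP : ContDiffOn ℝ ∞ P P.source)
    (hP' : ContDiffOn ℝ ∞ P.symm P.target) :
    e.trans P ∈ IsManifold.maximalAtlas (𝓡 m) ∞ M :=
  OpenPartialHomeomorph.mem_maximalAtlas_of_contMDiffOn _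
    ((contMDiffOn_iff_contDiffOn.2 hP).comp ((contMDiffOn_of_mem_maximalAtlas he).mono
      fun _ hx => hx.1) fun _ hx => hx.2)
    ((contMDiffOn_symm_of_mem_maximalAtlas he).comp ((contMDiffOn_iff_contDiffOn.2 hP').mono
      fun _ hx => hx.1) fun _ hx => hx.2)

theorem exists_contDiff_pd_eq (y : Coord m) (p : Fin m → ℝ) {C : Matrix (Fin m) (Fin m) ℝ}
    (hC : C.IsSymm) : ∃ u : Coord m → ℝ, ContDiff ℝ ∞ u ∧ (∀ i, pd i u y = p i) ∧
      ∀ i j, pd i (pd j u) y = C i j := by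
  -- the Taylor polynomial `∑ (pᵢ + ½ ∑ Cᵢⱼ xʲ) xⁱ` in `x = z - y`
  let x (i : Fin m) (z : Coord m) : ℝ := z i - y i
  let c (i : Fin m) (z : Coord m) : ℝ := p i + 1 / 2 * ∑ j, C i j * x j z
  have hcoord (i : Fin m) : ContDiff ℝ ∞ fun z : Coord m => z i :=
    (EuclideanSpace.proj i : Coord m →L[ℝ] ℝ).contDiff
  have hx i : ContDiff ℝ ∞ (x i) := (hcoord i).sub contDiff_const
  have hsum i : ContDiff ℝ ∞ fun z => ∑ j, C i j * x j z :=
    ContDiff.sum fun j _ => contDiff_const.mul (hx j)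
  have hc i : ContDiff ℝ ∞ (c i) := contDiff_const.add (contDiff_const.mul (hsum i))
  have d {u : Coord m → ℝ} (hu : ContDiff ℝ ∞ u) z : DifferentiableAt ℝ u z :=
    hu.differentiable (by simp) z
  have pd_x a i : pd a (x i) = fun _ => if i = a then 1 else 0 := by
    ext z
    rw [pd_sub (d (hcoord i) z) (differentiableAt_const _), pd_coord, pd_const, sub_zero]
  have pd_c a i : pd a (c i) y = 1 / 2 * C i a := by
    rw [pd_add (differentiableAt_const _) ((d (hsum i) y).const_mul _), pd_const,
      pd_const_mul (d (hsum i) y), pd_sum fun j _ => (d (hx j) y).const_mul _]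
    simp [pd_const_mul (d (hx _) y), pd_x]
  refine ⟨fun z => ∑ i, c i z * x i z, ContDiff.sum fun i _ => (hc i).mul (hx i), fun a => ?_,
    fun a b => ?_⟩
  · rw [pd_sum fun i _ => (d (hc i) y).fun_mul (d (hx i) y)]
    simp only [pd_mul (d (hc _) y) (d (hx _) y), pd_x]
    simp [c, x]
  · rw [pd_pd_sum isOpen_univ (fun i _ => ((hc i).mul (hx i)).contDiffOn) (Set.mem_univ y)]
    simp only [pd_pd_mul isOpen_univ (hc _).contDiffOn (hx _).contDiffOn (Set.mem_univ y), pd_x,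
      pd_c]
    simp [x, Finset.sum_add_distrib, hC.apply a b]
    ring

theorem IsMetricOn.exists_hess_eq_zero (hG : IsMetricOn G U) (hy : y ∈ U) (p : Fin m → ℝ) :
    ∃ u : Coord m → ℝ, ContDiff ℝ ∞ u ∧ (∀ i, pd i u y = p i) ∧ ∀ i j, hess G u i j y = 0 := by
  obtain ⟨u, hu, hpd, hpdpd⟩ := exists_contDiff_pd_eq y p
    (C := .of fun i j => ∑ k, christoffel G k i j y * p k)
    (Matrix.IsSymm.ext fun i j => by
      simp only [Matrix.of_apply, hG.christoffel_symm hy _ j i])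
  exact ⟨u, hu, hpd, fun i j => by simp [hess, hpdpd, hpd]⟩

theorem IsIsometryOn.congr {ψ' : Coord m → Coord m} (h : IsIsometryOn ψ G' G V U)
    (heq : Set.EqOn ψ ψ' V) : IsIsometryOn ψ' G' G V U where
  source := h.source
  target := h.target
  contDiffOn := h.contDiffOn.congr heq.symm
  mapsTo := h.mapsTo.congr heq
  pullback_eq z hz := by
    have hjac : jac ψ' z = jac ψ z := Matrix.ext fun a i =>
      pd_congr_of_eqOn h.source.isOpen (fun x hx => by simp only [heq hx]) hz i
    rw [h.pullback_eq z hz, coordPullback, coordPullback, hjac, heq hz]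

theorem IsIsometryOn.inv_apply_comp (h : IsIsometryOn ψ G' G V U) {z : Coord m} (hz : z ∈ V)
    (a b : Fin m) :
    (G (ψ z))⁻¹ a b = gradInner G' (fun x => ψ x a) (fun x => ψ x b) z := by
  rw [gradInner_eq_dotProduct, ← h.mul_inv_mul_transpose hz, Matrix.mul_assoc]
  rfl

/-- The inverse metric has components `⟨∇ψᵃ, ∇ψᵇ⟩` in the coordinates `ψ`, so its differential
vanishes if the Hessians of the `ψᵃ` do. -/
theorem IsIsometryOn.isNormalAt (h : IsIsometryOn ψ G' G V U) (hy : y ∈ V)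
    (hone : jac ψ y * (G' y)⁻¹ * (jac ψ y).transpose = 1)
    (hhess : ∀ a i j, hess G' (fun z => ψ z a) i j y = 0) : IsNormalAt G U (ψ y) := by
  have hG := h.target
  have hψy := h.mapsTo hy
  have hψ a := contDiffOn_coord h.contDiffOn a
  have hGinv : (G (ψ y))⁻¹ = 1 := (h.mul_inv_mul_transpose hy).symm.trans hone
  have hG1 : G (ψ y) = 1 := by simpa [hGinv] using hG.mul_inv hψy
  have hpd_comp a b : (fun i => pd i (fun z => (G (ψ z))⁻¹ a b) y) = 0 := by
    ext i
    rw [pd_congr_of_eqOn h.source.isOpen (fun z hz => h.inv_apply_comp hz a b) hy,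
      h.source.pd_gradInner (hψ a) (hψ b) hy]
    simp [hhess, dotProduct]
  have hpd_inv a b : (fun c => pd c (fun x => (G x)⁻¹ a b) (ψ y)) = 0 := by
    refine Matrix.vecMul_injective_of_isUnit
      ((Matrix.isUnit_iff_isUnit_det _).2 (h.isUnit_det_jac hy)) ?_
    exact (h.pd_comp_eq_vecMul hy (differentiableAt_of_contDiffOn hG.isOpen
      (hG.contDiffOn_inv a b) hψy)).symm.trans
      ((hpd_comp a b).trans (Matrix.zero_vecMul _).symm)
  refine ⟨hG, hψy, hG1, fun l i j => ?_⟩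
  have hpdMatrix : pdMatrix l (fun x => (G x)⁻¹) (ψ y) = 0 := by
    ext a b
    exact congrFun (hpd_inv a b) l
  have hinv := hG.pdMatrix_inv_mul hψy l
  rw [hpdMatrix, hGinv, Matrix.zero_mul, Matrix.one_mul, zero_eq_neg] at hinv
  exact congrFun₂ hinv i j

theorem exists_transpose_mul_self {A : Matrix (Fin m) (Fin m) ℝ} (hA : A.PosDef) :
    ∃ B : Matrix (Fin m) (Fin m) ℝ, IsUnit B.det ∧ B.transpose * B = A := by
  open scoped MatrixOrder Matrix.Norms.L2Operator in
  obtain ⟨B, hB, rfl⟩ := CStarAlgebra.isStrictlyPositive_iff_eq_star_mul_self.mp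
    hA.isStrictlyPositive
  exact ⟨B, (Matrix.isUnit_iff_isUnit_det _).1 hB, by
    rw [Matrix.star_eq_conjTranspose, Matrix.conjTranspose_eq_transpose_of_trivial]⟩

/-- The coordinates are chosen with vanishing Hessians and orthonormal gradients at `p`. -/
theorem exists_normal_chart [IsManifold (𝓡 m) ∞ M] (g : RiemMetric m M) (p : M) :
    ∃ e ∈ IsManifold.maximalAtlas (𝓡 m) ∞ M, p ∈ e.source ∧
      IsNormalAt (gram g e) e.target (e p) := by
  let e := chartAt (Coord m) p
  have he : e ∈ IsManifold.maximalAtlas (𝓡 m) ∞ M := IsManifold.chart_mem_maximalAtlas p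
  have hp : p ∈ e.source := mem_chart_source _ p
  have hG := isMetricOn_gram he g
  have hy := e.map_source hp
  obtain ⟨A, hA, hAG⟩ := exists_transpose_mul_self (hG.posDef _ hy)
  choose u hu hpd hhess using fun a => hG.exists_hess_eq_zero hy (A a)
  let ψ : Coord m → Coord m := fun x => WithLp.toLp 2 fun a => u a x
  have hψ : ContDiff ℝ ∞ ψ := contDiff_euclidean.2 hu
  have hjac : jac ψ (e p) = A := Matrix.ext hpd
  obtain ⟨P, hPψ, hyP, hPsymm⟩ := exists_openPartialHomeomorph_of_contDiff hψ (hjac ▸ hA)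
  have he₁ : e.trans P ∈ IsManifold.maximalAtlas (𝓡 m) ∞ M :=
    trans_mem_maximalAtlas he (hPψ ▸ hψ.contDiffOn) hPsymm
  have hp₁ : p ∈ (e.trans P).source := ⟨hp, hyP⟩
  have hisom : IsIsometryOn ψ (gram g e) (gram g (e.trans P))
      (e.target ∩ e.symm ⁻¹' (e.trans P).source) (e.trans P).target := by
    refine (isIsometryOn_gram he he₁ g).congr fun z hz => ?_
    simp [hPψ, e.right_inv hz.1]
  refine ⟨e.trans P, he₁, hp₁, ?_⟩
  have hp_eq : (e.trans P) p = ψ (e p) := by rw [← hPψ]; rfl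
  rw [hp_eq]
  refine hisom.isNormalAt ⟨hy, by simpa [e.left_inv hp] using hp₁⟩ ?_ hhess
  have hA' : IsUnit A.transpose.det := by rwa [Matrix.det_transpose]
  rw [hjac, ← hAG, Matrix.mul_inv_rev, ← Matrix.mul_assoc, Matrix.mul_nonsing_inv _ hA,
    Matrix.one_mul, Matrix.nonsing_inv_mul _ hA']

end

/-! ### The Laplacian and the gradient norm on a manifold -/

section

variable {m : ℕ} {U : Set (Coord m)} {u v : Coord m → ℝ} {y : Coord m}

theorem hess_congr (G : Coord m → Matrix (Fin m) (Fin m) ℝ) (h : u =ᶠ[nhds y] v) (i j : Fin m) :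
    hess G u i j y = hess G v i j y := by
  have hpd : pd j u =ᶠ[nhds y] pd j v := h.eventually_nhds.mono fun z hz => pd_congr hz j
  simp only [hess, pd_congr hpd, pd_congr h]

theorem coordLaplacian_congr (G : Coord m → Matrix (Fin m) (Fin m) ℝ) (h : u =ᶠ[nhds y] v) :
    coordLaplacian G u y = coordLaplacian G v y := by
  simp only [coordLaplacian, hess_congr G h]

theorem gradInner_self_congr (G : Coord m → Matrix (Fin m) (Fin m) ℝ) (h : u =ᶠ[nhds y] v) :
    gradInner G u u y = gradInner G v v y := by
  simp only [gradInner, pd_congr h]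

theorem pd_const_sub (c : ℝ) (u : Coord m → ℝ) (i : Fin m) :
    pd i (fun z => c - u z) = fun z => -pd i u z := by
  ext z
  simp [pd, fderiv_const_sub]

theorem hess_const_sub (G : Coord m → Matrix (Fin m) (Fin m) ℝ) (c : ℝ) (u : Coord m → ℝ)
    (i j : Fin m) : hess G (fun z => c - u z) i j y = -hess G u i j y := by
  have hneg : pd i (fun z => -pd j u z) y = -pd i (pd j u) y := by
    simpa using congrFun (pd_const_sub 0 (pd j u) i) y
  simp only [hess, pd_const_sub, hneg, mul_neg, Finset.sum_neg_distrib]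
  ring

theorem pd_eq_zero_of_gradInner_self_eq_zero {G : Coord m → Matrix (Fin m) (Fin m) ℝ}
    (hG : (G y).PosDef) (h : gradInner G u u y = 0) (i : Fin m) : pd i u y = 0 := by
  by_contra hi
  have hpos := hG.inv.dotProduct_mulVec_pos (x := fun i => pd i u y) fun h0 => hi (congrFun h0 i)
  rw [star_trivial] at hpos
  exact hpos.ne' (by rw [← h, gradInner_eq_dotProduct]; rfl)

theorem deriv_deriv_nonpos_of_isLocalMax {γ : ℝ → ℝ} {t : ℝ} (hc : ContinuousAt γ t)
    (hmax : IsLocalMax γ t) : deriv (deriv γ) t ≤ 0 := by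
  by_contra! hpos
  have hmin : IsLocalMin γ t := isLocalMin_of_deriv_deriv_pos hpos hmax.deriv_eq_zero hc
  have hconst : γ =ᶠ[nhds t] fun _ => γ t := by
    filter_upwards [hmin, hmax] with s h₁ h₂ using le_antisymm h₂ h₁
  have hzero : deriv (deriv γ) t = 0 := by
    rw [hconst.deriv.deriv_eq]
    simp
  exact hpos.ne' hzero

theorem pd_pd_nonpos_of_isLocalMax (hU : IsOpen U) (hu : ContDiffOn ℝ ∞ u U) (hy : y ∈ U)
    (hmax : IsLocalMax u y) (i : Fin m) : pd i (pd i u) y ≤ 0 := by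
  let γ : ℝ → Coord m := fun t => y + t • EuclideanSpace.single i 1
  have hγ0 : γ 0 = y := by simp [γ]
  have hγ (t : ℝ) : HasDerivAt γ (EuclideanSpace.single i 1) t := by
    have hline := ((hasDerivAt_id t).smul_const (EuclideanSpace.single i 1 : Coord m)).const_add y
    rwa [one_smul] at hline
  have htendsto : Filter.Tendsto γ (nhds 0) (nhds y) := by
    simpa [hγ0] using (hγ 0).continuousAt.tendsto
  have hderiv {w : Coord m → ℝ} (hw : ContDiffOn ℝ ∞ w U) {t : ℝ} (ht : γ t ∈ U) :
      HasDerivAt (fun t => w (γ t)) (pd i w (γ t)) t :=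
    (differentiableAt_of_contDiffOn hU hw ht).hasFDerivAt.comp_hasDerivAt t (hγ t)
  have hy0 : γ 0 ∈ U := by rwa [hγ0]
  have hfirst : deriv (fun t => u (γ t)) =ᶠ[nhds 0] fun t => pd i u (γ t) := by
    filter_upwards [htendsto.eventually (hU.mem_nhds hy)] with t ht using (hderiv hu ht).deriv
  have hsecond : deriv (deriv fun t => u (γ t)) 0 = pd i (pd i u) y := by
    rw [hfirst.deriv_eq, (hderiv (contDiffOn_pd hU hu i) hy0).deriv, hγ0]
  rw [← hsecond]
  refine deriv_deriv_nonpos_of_isLocalMax (hderiv hu hy0).continuousAt ?_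
  filter_upwards [htendsto.eventually hmax] with t ht
  rwa [hγ0]

end

section

variable {m : ℕ} {M : Type*} [TopologicalSpace M] {e e₁ : OpenPartialHomeomorph M (Coord m)}
  {u v : M → ℝ} {p : M}

theorem comp_symm_eventuallyEq (u : M → ℝ) (hp : p ∈ e.source) (hp₁ : p ∈ e₁.source) :
    (fun z => u (e.symm z)) =ᶠ[nhds (e p)] fun z => u (e₁.symm (e₁ (e.symm z))) := by
  filter_upwards [(e.tendsto_symm hp).eventually (e₁.open_source.mem_nhds hp₁)] with z hz
  rw [e₁.left_inv hz]

theorem isLocalMax_comp_symm (hp : p ∈ e.source) (h : IsLocalMax u p) :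
    IsLocalMax (fun z => u (e.symm z)) (e p) := by
  filter_upwards [(e.tendsto_symm hp).eventually h] with z hz
  simpa [e.left_inv hp] using hz

theorem pd_eq_zero_of_isLocallyConstant (hu : IsLocallyConstant u)
    (e : OpenPartialHomeomorph M (Coord m)) {z : Coord m} (hz : z ∈ e.target) (j : Fin m) :
    pd j (fun z => u (e.symm z)) z = 0 := by
  have hconst : (fun z => u (e.symm z)) =ᶠ[nhds z] fun _ => u (e.symm z) :=
    (e.symm.continuousAt hz).eventually (hu.eventually_eq (e.symm z))
  rw [pd_congr hconst, pd_const]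

variable [ChartedSpace (Coord m) M] [IsManifold (𝓡 m) ∞ M]

theorem contMDiff_of_forall_chart
    (h : ∀ e ∈ IsManifold.maximalAtlas (𝓡 m) ∞ M,
      ContDiffOn ℝ ∞ (fun z => u (e.symm z)) e.target) : ContMDiff (𝓡 m) 𝓘(ℝ, ℝ) ∞ u := by
  intro p
  have he := IsManifold.chart_mem_maximalAtlas (I := 𝓡 m) (n := ∞) p
  have hp := mem_chart_source (Coord m) p
  have hcomp := ((h _ he).contMDiffOn.contMDiffAt
    ((chartAt (Coord m) p).open_target.mem_nhds (mem_chart_target _ p))).comp p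
      (contMDiffAt_of_mem_maximalAtlas he hp)
  refine hcomp.congr_of_eventuallyEq ?_
  filter_upwards [(chartAt (Coord m) p).open_source.mem_nhds hp] with q hq
  rw [Function.comp_apply, (chartAt (Coord m) p).left_inv hq]

/-- The Laplacian of `u` on `(M, g)`, computed in the preferred chart at each point. -/
noncomputable def laplacian (g : RiemMetric m M) (u : M → ℝ) (p : M) : ℝ :=
  let e := chartAt (Coord m) p
  coordLaplacian (gram g e) (fun y => u (e.symm y)) (e p)

theorem laplacian_eq (g : RiemMetric m M) (he : e ∈ IsManifold.maximalAtlas (𝓡 m) ∞ M)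
    (hu : ContMDiff (𝓡 m) 𝓘(ℝ, ℝ) ∞ u) (hp : p ∈ e.source) :
    laplacian g u p = coordLaplacian (gram g e) (fun z => u (e.symm z)) (e p) := by
  have hp₀ := mem_chart_source (Coord m) p
  have hisom := isIsometryOn_gram (IsManifold.chart_mem_maximalAtlas p) he g
  rw [laplacian, coordLaplacian_congr _ (comp_symm_eventuallyEq u hp₀ hp),
    hisom.coordLaplacian_comp (u := fun z => u (e.symm z))
      ⟨mem_chart_target _ p, by simpa using hp⟩ (contDiffOn_comp_symm he hu),
    OpenPartialHomeomorph.left_inv _ hp₀]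

theorem gradNormSq_eq (g : RiemMetric m M) (he : e ∈ IsManifold.maximalAtlas (𝓡 m) ∞ M)
    (hu : ContMDiff (𝓡 m) 𝓘(ℝ, ℝ) ∞ u) (hp : p ∈ e.source) :
    gradNormSq g u p
      = gradInner (gram g e) (fun z => u (e.symm z)) (fun z => u (e.symm z)) (e p) := by
  have hp₀ := mem_chart_source (Coord m) p
  have hisom := isIsometryOn_gram (IsManifold.chart_mem_maximalAtlas p) he g
  have hd : DifferentiableAt ℝ (fun z => u (e.symm z)) (e p) :=
    differentiableAt_of_contDiffOn e.open_target (contDiffOn_comp_symm he hu) (e.map_source hp)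
  rw [← OpenPartialHomeomorph.left_inv _ hp₀] at hd
  rw [gradNormSq, gradInner_self_congr _ (comp_symm_eventuallyEq u hp₀ hp),
    hisom.gradInner_comp (u := fun z => u (e.symm z)) (v := fun z => u (e.symm z))
      ⟨mem_chart_target _ p, by simpa using hp⟩ hd hd,
    OpenPartialHomeomorph.left_inv _ hp₀]

theorem laplacian_symm_eq (g : RiemMetric m M) (he : e ∈ IsManifold.maximalAtlas (𝓡 m) ∞ M)
    (hu : ContMDiff (𝓡 m) 𝓘(ℝ, ℝ) ∞ u) {z : Coord m} (hz : z ∈ e.target) :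
    laplacian g u (e.symm z) = coordLaplacian (gram g e) (fun x => u (e.symm x)) z := by
  rw [laplacian_eq g he hu (e.map_target hz), e.right_inv hz]

theorem gradNormSq_symm_eq (g : RiemMetric m M) (he : e ∈ IsManifold.maximalAtlas (𝓡 m) ∞ M)
    (hu : ContMDiff (𝓡 m) 𝓘(ℝ, ℝ) ∞ u) {z : Coord m} (hz : z ∈ e.target) :
    gradNormSq g u (e.symm z)
      = gradInner (gram g e) (fun x => u (e.symm x)) (fun x => u (e.symm x)) z := by
  rw [gradNormSq_eq g he hu (e.map_target hz), e.right_inv hz]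

theorem contMDiff_laplacian (g : RiemMetric m M) (hu : ContMDiff (𝓡 m) 𝓘(ℝ, ℝ) ∞ u) :
    ContMDiff (𝓡 m) 𝓘(ℝ, ℝ) ∞ (laplacian g u) :=
  contMDiff_of_forall_chart fun _ he =>
    ((isMetricOn_gram he g).contDiffOn_coordLaplacian (contDiffOn_comp_symm he hu)).congr
      fun _ hz => laplacian_symm_eq g he hu hz

theorem contMDiff_gradNormSq (g : RiemMetric m M) (hu : ContMDiff (𝓡 m) 𝓘(ℝ, ℝ) ∞ u) :
    ContMDiff (𝓡 m) 𝓘(ℝ, ℝ) ∞ (gradNormSq g u) :=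
  contMDiff_of_forall_chart fun _ he =>
    ((isMetricOn_gram he g).contDiffOn_gradInner (contDiffOn_comp_symm he hu)
      (contDiffOn_comp_symm he hu)).congr fun _ hz => gradNormSq_symm_eq g he hu hz

theorem gradNormSq_nonneg (g : RiemMetric m M) (u : M → ℝ) (p : M) : 0 ≤ gradNormSq g u p :=
  gradInner_self_nonneg
    (posDef_gram (IsManifold.chart_mem_maximalAtlas p) g (mem_chart_target _ p)) _

theorem laplacian_congr (g : RiemMetric m M) (h : u =ᶠ[nhds p] v) :
    laplacian g u p = laplacian g v p :=
  coordLaplacian_congr _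
    (((chartAt (Coord m) p).tendsto_symm (mem_chart_source _ p)).eventually h)

theorem gradNormSq_congr (g : RiemMetric m M) (h : u =ᶠ[nhds p] v) :
    gradNormSq g u p = gradNormSq g v p :=
  gradInner_self_congr _
    (((chartAt (Coord m) p).tendsto_symm (mem_chart_source _ p)).eventually h)

theorem laplacian_const_sub (g : RiemMetric m M) (c : ℝ) (u : M → ℝ) (p : M) :
    laplacian g (fun q => c - u q) p = -laplacian g u p := by
  simp only [laplacian, coordLaplacian, metricTrace,
    hess_const_sub _ c fun y => u ((chartAt (Coord m) p).symm y), mul_neg,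
    Finset.sum_neg_distrib]

theorem gradNormSq_const_sub (g : RiemMetric m M) (c : ℝ) (u : M → ℝ) (p : M) :
    gradNormSq g (fun q => c - u q) p = gradNormSq g u p := by
  simp only [gradNormSq, gradInner,
    pd_const_sub c fun y => u ((chartAt (Coord m) p).symm y), neg_mul_neg]

theorem laplacian_const (g : RiemMetric m M) (c : ℝ) (p : M) : laplacian g (fun _ => c) p = 0 := by
  have hpd (j : Fin m) : pd j (fun _ : Coord m => c) = fun _ => 0 := funext fun y => pd_const c j y
  simp [laplacian, coordLaplacian, hess, metricTrace, hpd]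

theorem laplacian_sub_of_isLocallyConstant (g : RiemMetric m M) {F : M → ℝ}
    (hF : IsLocallyConstant F) (u : M → ℝ) (p : M) :
    laplacian g (fun q => F q - u q) p = -laplacian g u p := by
  rw [← laplacian_const_sub g (F p)]
  exact laplacian_congr g ((hF.eventually_eq p).mono fun q hq => by simp only [hq])

theorem gradNormSq_sub_of_isLocallyConstant (g : RiemMetric m M) {F : M → ℝ}
    (hF : IsLocallyConstant F) (u : M → ℝ) (p : M) :
    gradNormSq g (fun q => F q - u q) p = gradNormSq g u p := by
  rw [← gradNormSq_const_sub g (F p) u]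
  exact gradNormSq_congr g ((hF.eventually_eq p).mono fun q hq => by simp only [hq])

theorem laplacian_sum (g : RiemMetric m M) {ι : Type*} (s : Finset ι) {w : ι → M → ℝ}
    (hw : ∀ k, ContMDiff (𝓡 m) 𝓘(ℝ, ℝ) ∞ (w k)) (p : M) :
    laplacian g (fun q => ∑ k ∈ s, w k q) p = ∑ k ∈ s, laplacian g (w k) p := by
  obtain ⟨e, he, hp, hn⟩ := exists_normal_chart g p
  rw [laplacian_eq g he (contMDiff_finsetSum fun k _ => hw k) hp,
    Finset.sum_congr rfl fun k _ => laplacian_eq g he (hw k) hp]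
  simp only [hn.coordLaplacian_apply, hn.hess_apply]
  rw [Finset.sum_comm]
  exact Finset.sum_congr rfl fun i _ =>
    pd_pd_sum e.open_target (fun k _ => contDiffOn_comp_symm he (hw k)) hn.mem i i

theorem laplacian_mul_self (g : RiemMetric m M) (hu : ContMDiff (𝓡 m) 𝓘(ℝ, ℝ) ∞ u) (p : M) :
    laplacian g (fun q => u q * u q) p = 2 * (u p * laplacian g u p + gradNormSq g u p) := by
  obtain ⟨e, he, hp, hn⟩ := exists_normal_chart g p
  have hs := contDiffOn_comp_symm he hu
  rw [laplacian_eq (u := fun q => u q * u q) g he (hu.mul hu) hp, laplacian_eq g he hu hp,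
    gradNormSq_eq g he hu hp, hn.coordLaplacian_apply, hn.coordLaplacian_apply,
    hn.gradInner_apply, Finset.mul_sum, ← Finset.sum_add_distrib, Finset.mul_sum]
  refine Finset.sum_congr rfl fun i _ => ?_
  rw [hn.hess_apply, hn.hess_apply, pd_pd_mul e.open_target hs hs hn.mem, e.left_inv hp]
  ring

theorem gradNormSq_eq_zero_of_isLocalMax (g : RiemMetric m M) (h : IsLocalMax u p) :
    gradNormSq g u p = 0 := by
  have hpd := (isLocalMax_comp_symm (mem_chart_source (Coord m) p) h).fderiv_eq_zero
  simp [gradNormSq, gradInner, metricTrace, pd, hpd]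

theorem laplacian_nonpos_of_isLocalMax (g : RiemMetric m M) (hu : ContMDiff (𝓡 m) 𝓘(ℝ, ℝ) ∞ u)
    (h : IsLocalMax u p) : laplacian g u p ≤ 0 := by
  obtain ⟨e, he, hp, hn⟩ := exists_normal_chart g p
  rw [laplacian_eq g he hu hp, hn.coordLaplacian_apply]
  refine Finset.sum_nonpos fun i _ => ?_
  rw [hn.hess_apply]
  exact pd_pd_nonpos_of_isLocalMax e.open_target (contDiffOn_comp_symm he hu) hn.mem
    (isLocalMax_comp_symm hp h) i

theorem laplacian_nonneg_of_isLocalMin (g : RiemMetric m M) (hu : ContMDiff (𝓡 m) 𝓘(ℝ, ℝ) ∞ u)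
    (h : IsLocalMin u p) : 0 ≤ laplacian g u p := by
  have hneg := laplacian_nonpos_of_isLocalMax g (contMDiff_const.sub hu)
    (u := fun q => 0 - u q) (by simpa using h.neg)
  rwa [laplacian_const_sub, neg_nonpos] at hneg

theorem isLocallyConstant_of_gradNormSq_eq_zero (g : RiemMetric m M)
    (hu : ContMDiff (𝓡 m) 𝓘(ℝ, ℝ) ∞ u) (h : ∀ p, gradNormSq g u p = 0) :
    IsLocallyConstant u := by
  rw [IsLocallyConstant.iff_eventually_eq]
  intro p
  have he := IsManifold.chart_mem_maximalAtlas (I := 𝓡 m) (n := ∞) p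
  have hp := mem_chart_source (Coord m) p
  set e := chartAt (Coord m) p
  obtain ⟨r, hr, hball⟩ := Metric.isOpen_iff.1 e.open_target (e p) (e.map_source hp)
  have hpd : ∀ z ∈ e.target, ∀ j, pd j (fun z => u (e.symm z)) z = 0 := fun z hz =>
    pd_eq_zero_of_gradInner_self_eq_zero (posDef_gram he g hz)
      (by rw [← gradNormSq_symm_eq g he hu hz, h])
  have hconst : ∀ z ∈ Metric.ball (e p) r, u (e.symm z) = u p := fun z hz => by
    simpa [e.left_inv hp] using Metric.isOpen_ball.is_const_of_fderiv_eq_zero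
      (convex_ball (e p) r).isPreconnected
      (((contDiffOn_comp_symm he hu).differentiableOn (by simp)).mono hball)
      (fun x hx => fderiv_eq_zero_iff_pd.2 (hpd x (hball hx))) hz (Metric.mem_ball_self hr)
  filter_upwards [e.open_source.mem_nhds hp,
    (e.continuousAt hp).eventually (Metric.ball_mem_nhds (e p) hr)] with q hq hqr
  rw [← hconst _ hqr, e.left_inv hq]

end

/-! ### The divergence theorem in coordinates -/

section

variable {m : ℕ} {y : Coord m}

theorem pd_det {A : Coord m → Matrix (Fin m) (Fin m) ℝ}
    (hA : ∀ k l, DifferentiableAt ℝ (fun z => A z k l) y) (i : Fin m) :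
    pd i (fun z => (A z).det) y = ((A y).adjugate * pdMatrix i A y).trace := by
  let D : ContinuousMultilinearMap ℝ (fun _ : Fin m => Fin m → ℝ) ℝ :=
    ⟨(Matrix.detRowAlternating (n := Fin m) (R := ℝ)).toMultilinearMap,
      Continuous.matrix_det continuous_id⟩
  have hrows : HasFDerivAt (fun z k l => A z k l)
      (ContinuousLinearMap.pi fun k => ContinuousLinearMap.pi fun l =>
        fderiv ℝ (fun z => A z k l) y) y :=
    hasFDerivAt_pi.2 fun k => hasFDerivAt_pi.2 fun l => (hA k l).hasFDerivAt
  have hdet : HasFDerivAt (fun z => (A z).det) _ y := (D.hasFDerivAt (A y)).comp y hrows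
  calc pd i (fun z => (A z).det) y
      = ∑ k, ((A y).updateRow k (pdMatrix i A y k)).det := by
        rw [pd, hdet.fderiv]
        exact D.linearDeriv_apply _ _
    _ = ∑ k, (pdMatrix i A y * (A y).adjugate) k k := by
        refine Finset.sum_congr rfl fun k _ => ?_
        rw [← Matrix.cramer_transpose_apply, Matrix.cramer_eq_adjugate_mulVec,
          ← Matrix.adjugate_transpose, Matrix.mulVec_transpose]
        rfl
    _ = ((A y).adjugate * pdMatrix i A y).trace := Matrix.trace_mul_comm _ _

theorem integrable_pd {X : Coord m → ℝ} (hX : ContDiff ℝ ∞ X) (hc : HasCompactSupport X)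
    (i : Fin m) : Integrable (pd i X) :=
  (contDiffOn_univ.1 (contDiffOn_pd isOpen_univ hX.contDiffOn i)).continuous
    |>.integrable_of_hasCompactSupport (hc.fderiv_apply (𝕜 := ℝ) _)

theorem integral_pd_eq_zero {X : Coord m → ℝ} (hX : ContDiff ℝ ∞ X) (hc : HasCompactSupport X)
    (i : Fin m) : ∫ y, pd i X y = 0 := by
  have parts := integral_mul_fderiv_eq_neg_fderiv_mul_of_integrable
    (μ := (volume : Measure (Coord m))) (f := fun _ => (1 : ℝ)) (g := X)
    (v := EuclideanSpace.single i (1 : ℝ)) (by simp)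
    (by simpa using! integrable_pd hX hc i)
    (by simpa using hX.continuous.integrable_of_hasCompactSupport hc)
    (fun x _ => differentiableAt_const _) (fun x _ => hX.differentiable (by simp) x)
  simpa [pd] using parts

variable {U K : Set (Coord m)} {X : Coord m → ℝ}

theorem indicator_eq_zero_of_notMem (h : Set.EqOn X 0 (U \ K)) (hy : y ∉ K) :
    U.indicator X y = 0 :=
  Set.indicator_apply_eq_zero.2 fun hU => h ⟨hU, hy⟩

theorem indicator_eventuallyEq_zero (hK : IsClosed K) (h : Set.EqOn X 0 (U \ K)) (hy : y ∉ K) :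
    U.indicator X =ᶠ[nhds y] fun _ => 0 := by
  filter_upwards [hK.isOpen_compl.mem_nhds hy] with z hz
    using indicator_eq_zero_of_notMem h hz

theorem contDiff_indicator (hU : IsOpen U) (hK : IsClosed K) (hKU : K ⊆ U)
    (hX : ContDiffOn ℝ ∞ X U) (h : Set.EqOn X 0 (U \ K)) : ContDiff ℝ ∞ (U.indicator X) := by
  refine contDiff_iff_contDiffAt.2 fun z => ?_
  by_cases hz : z ∈ U
  · exact (hX.congr (Set.eqOn_indicator)).contDiffAt (hU.mem_nhds hz)
  · exact contDiffAt_const.congr_of_eventuallyEq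
      (indicator_eventuallyEq_zero hK h fun hzK => hz (hKU hzK))

theorem pd_indicator (hU : IsOpen U) (hK : IsClosed K) (hKU : K ⊆ U)
    (h : Set.EqOn X 0 (U \ K)) (i : Fin m) : pd i (U.indicator X) = U.indicator (pd i X) := by
  ext z
  by_cases hz : z ∈ U
  · rw [Set.indicator_of_mem hz, pd_congr_of_eqOn hU Set.eqOn_indicator hz]
  · rw [Set.indicator_of_notMem hz,
      pd_congr (indicator_eventuallyEq_zero hK h fun hzK => hz (hKU hzK)), pd_const]

theorem setIntegral_sum_pd_eq_zero {X : Fin m → Coord m → ℝ} (hU : IsOpen U) (hK : IsCompact K)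
    (hKU : K ⊆ U) (hX : ∀ i, ContDiffOn ℝ ∞ (X i) U) (h : ∀ i, Set.EqOn (X i) 0 (U \ K)) :
    ∫ y in U, ∑ i, pd i (X i) y = 0 := by
  have hsmooth i := contDiff_indicator hU hK.isClosed hKU (hX i) (h i)
  have hsupp i : HasCompactSupport (U.indicator (X i)) :=
    HasCompactSupport.intro hK fun z hz => indicator_eq_zero_of_notMem (h i) hz
  have hint i : IntegrableOn (pd i (X i)) U := by
    rw [← integrable_indicator_iff hU.measurableSet, ← pd_indicator hU hK.isClosed hKU (h i)]
    exact integrable_pd (hsmooth i) (hsupp i) i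
  rw [integral_finsetSum _ fun i _ => hint i]
  refine Finset.sum_eq_zero fun i _ => ?_
  rw [← integral_indicator hU.measurableSet, ← pd_indicator hU hK.isClosed hKU (h i)]
  exact integral_pd_eq_zero (hsmooth i) (hsupp i) i

end

namespace IsMetricOn

variable {m : ℕ} {G : Coord m → Matrix (Fin m) (Fin m) ℝ} {U : Set (Coord m)}
  {u : Coord m → ℝ} {y : Coord m}

theorem contDiffOn_sqrt_det (hG : IsMetricOn G U) : ContDiffOn ℝ ∞ (fun z => √(G z).det) U :=
  (contDiffOn_det hG.smooth).sqrt fun z hz => (hG.posDef z hz).det_pos.ne'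

theorem contDiffOn_grad (hG : IsMetricOn G U) (hu : ContDiffOn ℝ ∞ u U) (k : Fin m) :
    ContDiffOn ℝ ∞ (fun z => grad G u z k) U := by
  simp only [grad, Matrix.mulVec, dotProduct]
  exact ContDiffOn.sum fun l _ => (hG.contDiffOn_inv k l).mul (contDiffOn_pd hG.isOpen hu l)

theorem trace_inv_mul_pdMatrix (hG : IsMetricOn G U) (hy : y ∈ U) (i : Fin m) :
    ((G y)⁻¹ * pdMatrix i G y).trace = 2 * (connectionMatrix G i y).trace := by
  rw [hG.pdMatrix_eq hy, Matrix.mul_add, Matrix.trace_add, Matrix.transpose_mul, hG.transpose_eq hy,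
    ← Matrix.mul_assoc, hG.inv_mul hy, Matrix.one_mul, Matrix.trace_mul_comm, Matrix.mul_assoc,
    hG.mul_inv hy, Matrix.mul_one, Matrix.trace_transpose, two_mul]

theorem pd_sqrt_det (hG : IsMetricOn G U) (hy : y ∈ U) (i : Fin m) :
    pd i (fun z => √(G z).det) y = √(G y).det * (connectionMatrix G i y).trace := by
  have hpos := (hG.posDef y hy).det_pos
  have hdiff := differentiableAt_of_contDiffOn hG.isOpen (contDiffOn_det hG.smooth) hy
  have hdet : pd i (fun z => (G z).det) y = (G y).det * (2 * (connectionMatrix G i y).trace) := by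
    rw [pd_det (fun k l => differentiableAt_of_contDiffOn hG.isOpen (hG.smooth k l) hy),
      ← hG.trace_inv_mul_pdMatrix hy, Matrix.inv_def, Ring.inverse_eq_inv', Matrix.smul_mul,
      Matrix.trace_smul, smul_eq_mul, mul_inv_cancel_left₀ hpos.ne']
  calc pd i (fun z => √(G z).det) y = 1 / (2 * √(G y).det) * pd i (fun z => (G z).det) y := by
        rw [pd, fderiv_sqrt hdiff hpos.ne']
        rfl
    _ = √(G y).det * (connectionMatrix G i y).trace := by
        rw [hdet]
        nth_rw 2 [← Real.mul_self_sqrt hpos.le]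
        field_simp

theorem pd_grad (hG : IsMetricOn G U) (hu : ContDiffOn ℝ ∞ u U) (hy : y ∈ U) (i : Fin m) :
    (fun k => pd i (fun z => grad G u z k) y)
      = (G y)⁻¹.mulVec (fun l => hess G u i l y)
        - (connectionMatrix G i y).mulVec (grad G u y) := by
  have hI k l := differentiableAt_of_contDiffOn hG.isOpen (hG.contDiffOn_inv k l) hy
  have hdu l := differentiableAt_of_contDiffOn hG.isOpen (contDiffOn_pd hG.isOpen hu l) hy
  have leibniz : (fun k => pd i (fun z => grad G u z k) y)
      = (pdMatrix i (fun z => (G z)⁻¹) y).mulVec (fun l => pd l u y)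
        + (G y)⁻¹.mulVec fun l => pd i (pd l u) y := by
    ext k
    simp only [grad, Matrix.mulVec, dotProduct, Pi.add_apply, pdMatrix, Matrix.of_apply]
    rw [pd_sum fun l _ => (hI k l).fun_mul (hdu l), ← Finset.sum_add_distrib]
    exact Finset.sum_congr rfl fun l _ => pd_mul (hI k l) (hdu l) i
  rw [leibniz, hG.pdMatrix_inv hy, hess_eq_sub_vecMul, Matrix.mulVec_sub, grad, Matrix.neg_mulVec,
    Matrix.add_mulVec, Matrix.transpose_mul, hG.transpose_inv_eq hy, ← Matrix.mulVec_mulVec,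
    ← Matrix.mulVec_mulVec, Matrix.mulVec_transpose]
  abel

theorem sqrt_det_mul_coordLaplacian (hG : IsMetricOn G U) (hu : ContDiffOn ℝ ∞ u U) (hy : y ∈ U) :
    √(G y).det * coordLaplacian G u y = ∑ i, pd i (fun z => √(G z).det * grad G u z i) y := by
  have hsqrt := differentiableAt_of_contDiffOn hG.isOpen hG.contDiffOn_sqrt_det hy
  have hgrad i := differentiableAt_of_contDiffOn hG.isOpen (hG.contDiffOn_grad hu i) hy
  have hdiv : ∑ i, pd i (fun z => grad G u z i) y
      = coordLaplacian G u y - ∑ i, (connectionMatrix G i y).trace * grad G u y i := by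
    rw [Finset.sum_congr rfl fun i _ => congrFun (hG.pd_grad hu hy i) i]
    simp only [Pi.sub_apply, Finset.sum_sub_distrib]
    refine congrArg₂ (· - ·) rfl ?_
    simp only [Matrix.mulVec, dotProduct, Matrix.trace, Matrix.diag, Finset.sum_mul]
    rw [Finset.sum_comm]
    simp only [connectionMatrix, Matrix.of_apply]
    exact Finset.sum_congr rfl fun k _ => Finset.sum_congr rfl fun i _ => by
      rw [hG.christoffel_symm hy i i k]
  simp only [fun i => pd_mul hsqrt (hgrad i) i, hG.pd_sqrt_det hy, mul_assoc]
  rw [Finset.sum_add_distrib, ← Finset.mul_sum, ← Finset.mul_sum, hdiv]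
  ring

theorem integral_coordLaplacian_eq_zero {K : Set (Coord m)} (hG : IsMetricOn G U)
    (hu : ContDiffOn ℝ ∞ u U) (hK : IsCompact K) (hKU : K ⊆ U) (h : Set.EqOn u 0 (U \ K)) :
    ∫ y in U, √(G y).det * coordLaplacian G u y = 0 := by
  have hU := hG.isOpen
  have hpd z (hz : z ∈ U \ K) (j : Fin m) : pd j u z = 0 := by
    rw [pd_congr_of_eqOn (hU.sdiff hK.isClosed) (v := fun _ => 0) h hz, pd_const]
  rw [setIntegral_congr_fun hU.measurableSet fun y hy => hG.sqrt_det_mul_coordLaplacian hu hy]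
  refine setIntegral_sum_pd_eq_zero hU hK hKU
    (fun i => hG.contDiffOn_sqrt_det.mul (hG.contDiffOn_grad hu i)) fun i z hz => ?_
  simp [grad, Matrix.mulVec, dotProduct, hpd z hz]

end IsMetricOn

/-! ### The Riemannian volume measure -/

theorem det_fderiv_eq_det_jac {m : ℕ} {ψ : Coord m → Coord m} {z : Coord m}
    (hψ : DifferentiableAt ℝ ψ z) : (fderiv ℝ ψ z).det = (jac ψ z).det := by
  rw [ContinuousLinearMap.det, ← toLpLin_jac hψ, Matrix.toLpLin_eq_toLin, LinearMap.det_toLin]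

section

variable {m : ℕ} {M : Type*} [TopologicalSpace M] {e e₁ : OpenPartialHomeomorph M (Coord m)}
  {A : Set M}

theorem isOpen_symm_preimage (e : OpenPartialHomeomorph M (Coord m)) (hA : IsOpen A) :
    IsOpen (e.symm ⁻¹' A ∩ e.target) := by
  rw [Set.inter_comm]
  exact e.continuousOn_symm.isOpen_inter_preimage e.open_target hA

theorem image_symm_preimage (hAe : A ⊆ e.source) (hAe₁ : A ⊆ e₁.source) :
    (fun z => e₁ (e.symm z)) '' (e.symm ⁻¹' A ∩ e.target) = e₁.symm ⁻¹' A ∩ e₁.target := by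
  ext y
  constructor
  · rintro ⟨z, ⟨hz, -⟩, rfl⟩
    exact ⟨by rwa [Set.mem_preimage, e₁.left_inv (hAe₁ hz)], e₁.map_source (hAe₁ hz)⟩
  · rintro ⟨hy, hyt⟩
    refine ⟨e (e₁.symm y), ⟨?_, e.map_source (hAe hy)⟩, ?_⟩
    · rwa [Set.mem_preimage, e.left_inv (hAe hy)]
    · simp only [e.left_inv (hAe hy), e₁.right_inv hyt]

theorem aemeasurable_symm [MeasurableSpace M] [BorelSpace M]
    (e : OpenPartialHomeomorph M (Coord m)) :
    AEMeasurable e.symm (volume.restrict e.target) :=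
  e.continuousOn_symm.aemeasurable e.open_target.measurableSet

theorem measurableSet_symm_preimage [MeasurableSpace M] [BorelSpace M]
    (e : OpenPartialHomeomorph M (Coord m)) (hA : MeasurableSet A) :
    MeasurableSet (e.symm ⁻¹' A ∩ e.target) := by
  have hmeas : Measurable (e.target.domRestrict e.symm) :=
    (continuousOn_iff_continuous_domRestrict.1 e.continuousOn_symm).measurable
  convert e.open_target.measurableSet.subtype_image (hmeas hA) using 1
  ext z
  simp [and_comm, Set.domRestrict]

variable [ChartedSpace (Coord m) M] [IsManifold (𝓡 m) ∞ M]

/-- The density `√(det gᵢⱼ)` of the Riemannian volume in the chart `e`. -/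
noncomputable def volDensity (g : RiemMetric m M) (e : OpenPartialHomeomorph M (Coord m))
    (y : Coord m) : ENNReal :=
  ENNReal.ofReal √(gram g e y).det

theorem aemeasurable_volDensity (he : e ∈ IsManifold.maximalAtlas (𝓡 m) ∞ M)
    (g : RiemMetric m M) : AEMeasurable (volDensity g e) (volume.restrict e.target) :=
  ((isMetricOn_gram he g).contDiffOn_sqrt_det.continuousOn.aemeasurable
    e.open_target.measurableSet).ennreal_ofReal

theorem volDensity_eq (he : e ∈ IsManifold.maximalAtlas (𝓡 m) ∞ M)
    (he₁ : e₁ ∈ IsManifold.maximalAtlas (𝓡 m) ∞ M) (g : RiemMetric m M) {z : Coord m}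
    (hz : z ∈ e.target ∩ e.symm ⁻¹' e₁.source) :
    volDensity g e z = ENNReal.ofReal |(fderiv ℝ (fun x => e₁ (e.symm x)) z).det|
      * volDensity g e₁ (e₁ (e.symm z)) := by
  have hisom := isIsometryOn_gram he he₁ g
  rw [volDensity, volDensity, hisom.pullback_eq z hz, coordPullback, Matrix.det_mul, Matrix.det_mul,
    Matrix.det_transpose, det_fderiv_eq_det_jac (hisom.differentiableAt hz), mul_right_comm,
    ← sq, Real.sqrt_mul (sq_nonneg _), Real.sqrt_sq_eq_abs, ENNReal.ofReal_mul (abs_nonneg _)]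

variable [MeasurableSpace M] [BorelSpace M]

theorem chartVolume_apply (g : RiemMetric m M) (e : OpenPartialHomeomorph M (Coord m))
    (hA : MeasurableSet A) :
    chartVolume g e A = ∫⁻ y in e.symm ⁻¹' A ∩ e.target, volDensity g e y := by
  rw [chartVolume, Measure.map_apply_of_aemeasurable
    ((aemeasurable_symm e).mono_ac (withDensity_absolutelyContinuous _ _)) hA,
    withDensity_apply', Measure.restrict_restrict' e.open_target.measurableSet]
  rfl

theorem chartVolume_inter_source (g : RiemMetric m M) (e : OpenPartialHomeomorph M (Coord m))
    (hA : MeasurableSet A) : chartVolume g e (A ∩ e.source) = chartVolume g e A := by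
  rw [chartVolume_apply g e (hA.inter e.open_source.measurableSet), chartVolume_apply g e hA]
  congr 2
  ext z
  simp +contextual [e.map_target]

theorem chartVolume_eq (he : e ∈ IsManifold.maximalAtlas (𝓡 m) ∞ M)
    (he₁ : e₁ ∈ IsManifold.maximalAtlas (𝓡 m) ∞ M) (g : RiemMetric m M)
    (hA : MeasurableSet A) (hAe : A ⊆ e.source) (hAe₁ : A ⊆ e₁.source) :
    chartVolume g e A = chartVolume g e₁ A := by
  have hmem z (hz : z ∈ e.symm ⁻¹' A ∩ e.target) : z ∈ e.target ∩ e.symm ⁻¹' e₁.source :=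
    ⟨hz.2, hAe₁ hz.1⟩
  have hinj : Set.InjOn (fun z => e₁ (e.symm z)) (e.symm ⁻¹' A ∩ e.target) := fun z hz w hw hzw =>
    e.symm.injOn hz.2 hw.2 (e₁.injOn (hAe₁ hz.1) (hAe₁ hw.1) hzw)
  rw [chartVolume_apply g e hA, chartVolume_apply g e₁ hA, ← image_symm_preimage hAe hAe₁,
    lintegral_image_eq_lintegral_abs_det_fderiv_mul volume (measurableSet_symm_preimage e hA)
      (fun z hz => ((isIsometryOn_gram he he₁ g).differentiableAt
        (hmem z hz)).hasFDerivAt.hasFDerivWithinAt) hinj]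
  exact setLIntegral_congr_fun (measurableSet_symm_preimage e hA) fun z hz =>
    volDensity_eq he he₁ g (hmem z hz)

theorem riemannianVolume_le (he : e ∈ IsManifold.maximalAtlas (𝓡 m) ∞ M) (g : RiemMetric m M) :
    riemannianVolume g ≤ chartVolume g e + (⊤ : Measure M).restrict e.sourceᶜ := by
  refine iSup₂_le fun e₁ he₁ => Measure.le_iff.2 fun B hB => ?_
  have hs := e.open_source.measurableSet
  rw [Measure.add_apply, Measure.restrict_apply hB, ← measure_inter_add_sdiff B hs]
  refine add_le_add ?_ ((le_top : chartVolume g e₁ ≤ ⊤) _)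
  rw [← chartVolume_inter_source g e₁ (hB.inter hs), ← chartVolume_eq he he₁ g
    ((hB.inter hs).inter e₁.open_source.measurableSet) (fun x hx => hx.1.2) (fun x hx => hx.2)]
  exact measure_mono fun x hx => hx.1.1

theorem riemannianVolume_apply (he : e ∈ IsManifold.maximalAtlas (𝓡 m) ∞ M) (g : RiemMetric m M)
    (hA : MeasurableSet A) (hAe : A ⊆ e.source) : riemannianVolume g A = chartVolume g e A := by
  refine le_antisymm ((riemannianVolume_le he g A).trans_eq ?_)
    (le_iSup₂ (f := fun e (_ : e ∈ IsManifold.maximalAtlas (𝓡 m) ∞ M) => chartVolume g e) e he A)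
  rw [Measure.add_apply, Measure.restrict_apply hA,
    Set.disjoint_iff_inter_eq_empty.1 (Set.disjoint_compl_right_iff_subset.2 hAe), measure_empty,
    add_zero]

theorem riemannianVolume_restrict (he : e ∈ IsManifold.maximalAtlas (𝓡 m) ∞ M)
    (g : RiemMetric m M) : (riemannianVolume g).restrict e.source = chartVolume g e := by
  ext A hA
  rw [Measure.restrict_apply hA, riemannianVolume_apply he g
    (hA.inter e.open_source.measurableSet) Set.inter_subset_right, chartVolume_inter_source g e hA]

theorem isOpenPosMeasure_riemannianVolume (g : RiemMetric m M) :
    (riemannianVolume g).IsOpenPosMeasure := by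
  refine ⟨fun U hU ⟨p, hp⟩ h0 => ?_⟩
  have he := IsManifold.chart_mem_maximalAtlas (I := 𝓡 m) (n := ∞) p
  have hpe := mem_chart_source (Coord m) p
  set e := chartAt (Coord m) p
  have hUe : IsOpen (U ∩ e.source) := hU.inter e.open_source
  set B := e.symm ⁻¹' (U ∩ e.source) ∩ e.target
  have hB : IsOpen B := isOpen_symm_preimage e hUe
  have hpB : e p ∈ B := ⟨by simpa [e.left_inv hpe] using ⟨hp, hpe⟩, e.map_source hpe⟩
  have hzero : ∫⁻ y in B, volDensity g e y = 0 := by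
    rw [← chartVolume_apply g e hUe.measurableSet, ← riemannianVolume_apply he g
      hUe.measurableSet Set.inter_subset_right]
    exact measure_mono_null Set.inter_subset_left h0
  have hpos y (hy : y ∈ B) : volDensity g e y ≠ 0 := by
    have hdet := (posDef_gram he g hy.2).det_pos
    simpa [volDensity] using hdet
  have hmeas : AEMeasurable (volDensity g e) (volume.restrict B) :=
    (aemeasurable_volDensity he g).mono_measure
      (Measure.restrict_mono Set.inter_subset_right le_rfl)
  have hfalse : ∀ᵐ _ ∂volume.restrict B, False := by
    filter_upwards [(lintegral_eq_zero_iff' hmeas).1 hzero, ae_restrict_mem hB.measurableSet]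
      with y hy hyB using hpos y hyB hy
  rw [Filter.eventually_false_iff_eq_bot, ae_eq_bot, Measure.restrict_eq_zero] at hfalse
  exact hB.measure_ne_zero volume ⟨_, hpB⟩ hfalse

theorem isFiniteMeasure_riemannianVolume [CompactSpace M] (g : RiemMetric m M) :
    IsFiniteMeasure (riemannianVolume g) := by
  refine ⟨isCompact_univ.measure_lt_top_of_nhdsWithin fun p _ => ?_⟩
  have he := IsManifold.chart_mem_maximalAtlas (I := 𝓡 m) (n := ∞) p
  have hpe := mem_chart_source (Coord m) p
  set e := chartAt (Coord m) p
  obtain ⟨r, hr, hball⟩ := Metric.nhds_basis_closedBall.mem_iff.1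
    (e.open_target.mem_nhds (e.map_source hpe))
  set A : Set M := e.source ∩ e ⁻¹' Metric.ball (e p) r
  have hA : IsOpen A := e.continuousOn.isOpen_inter_preimage e.open_source Metric.isOpen_ball
  refine ⟨A, mem_nhdsWithin_of_mem_nhds (hA.mem_nhds ⟨hpe, Metric.mem_ball_self hr⟩), ?_⟩
  rw [riemannianVolume_apply he g hA.measurableSet Set.inter_subset_left,
    chartVolume_apply g e hA.measurableSet]
  have hsub : e.symm ⁻¹' A ∩ e.target ⊆ Metric.closedBall (e p) r := fun z hz =>
    Metric.ball_subset_closedBall (by simpa [e.right_inv hz.2] using hz.1.2)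
  have hint : IntegrableOn (fun y => √(gram g e y).det) (Metric.closedBall (e p) r) :=
    ((isMetricOn_gram he g).contDiffOn_sqrt_det.continuousOn.mono hball).integrableOn_compact
      (isCompact_closedBall _ _)
  exact (lintegral_mono_set hsub).trans_lt hint.lintegral_lt_top

theorem setIntegral_riemannianVolume (he : e ∈ IsManifold.maximalAtlas (𝓡 m) ∞ M)
    (g : RiemMetric m M) {k : M → ℝ} (hk : Continuous k) :
    ∫ p in e.source, k p ∂(riemannianVolume g)
      = ∫ y in e.target, √(gram g e y).det * k (e.symm y) := by
  have hdensity : AEMeasurable (fun y => ENNReal.ofReal √(gram g e y).det)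
    (volume.restrict e.target) := aemeasurable_volDensity he g
  rw [riemannianVolume_restrict he g, chartVolume, integral_map
    ((aemeasurable_symm e).mono_ac (withDensity_absolutelyContinuous _ _))
    hk.measurable.aestronglyMeasurable, integral_withDensity_eq_integral_toReal_smul₀ hdensity
    (Filter.Eventually.of_forall fun _ => ENNReal.ofReal_lt_top)]
  simp only [smul_eq_mul, ENNReal.toReal_ofReal (Real.sqrt_nonneg _)]

variable [CompactSpace M] {g : RiemMetric m M} {u : M → ℝ}

theorem integral_laplacian_eq_zero_of_tsupport_subset (he : e ∈ IsManifold.maximalAtlas (𝓡 m) ∞ M)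
    (hu : ContMDiff (𝓡 m) 𝓘(ℝ, ℝ) ∞ u) (hs : tsupport u ⊆ e.source) :
    ∫ p, laplacian g u p ∂(riemannianVolume g) = 0 := by
  have hzero : ∀ p, p ∉ e.source → laplacian g u p = 0 := fun p hp => by
    rw [laplacian_congr g (notMem_tsupport_iff_eventuallyEq.1 fun h => hp (hs h))]
    exact laplacian_const g 0 p
  rw [← setIntegral_eq_integral_of_forall_compl_eq_zero hzero,
    setIntegral_riemannianVolume he g (contMDiff_laplacian g hu).continuous,
    setIntegral_congr_fun e.open_target.measurableSet fun z hz => by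
      rw [laplacian_symm_eq g he hu hz]]
  refine (isMetricOn_gram he g).integral_coordLaplacian_eq_zero (K := e '' tsupport u)
    (contDiffOn_comp_symm he hu)
    ((isClosed_tsupport u).isCompact.image_of_continuousOn (e.continuousOn.mono hs))
    (Set.image_subset_iff.2 fun p hp => e.map_source (hs hp)) fun z hz => ?_
  by_contra hne
  exact hz.2 ⟨e.symm z, subset_tsupport u hne, e.right_inv hz.1⟩

theorem exists_finset_sum_eq_one (m : ℕ) (M : Type*) [TopologicalSpace M] [ChartedSpace (Coord m) M]
    [IsManifold (𝓡 m) ∞ M] [CompactSpace M] [T2Space M] :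
    ∃ (s : Finset M) (ρ : M → M → ℝ), (∀ k, ContMDiff (𝓡 m) 𝓘(ℝ, ℝ) ∞ (ρ k)) ∧
      (∀ k, tsupport (ρ k) ⊆ (chartAt (Coord m) k).source) ∧ ∀ p, ∑ k ∈ s, ρ k p = 1 := by
  obtain ⟨ρ, hρ⟩ := SmoothPartitionOfUnity.exists_isSubordinate_chartAt_source (𝓡 m) M
  have hfin := ρ.locallyFinite.finite_nonempty_of_compact
  refine ⟨hfin.toFinset, fun k => ρ k, fun k => (ρ k).contMDiff, hρ, fun p => ?_⟩
  rw [← ρ.sum_eq_one (Set.mem_univ p)]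
  refine (finsum_eq_sum_of_support_subset _ fun k hk => ?_).symm
  rw [Set.Finite.coe_toFinset]
  exact ⟨p, hk⟩

theorem integral_laplacian_eq_zero [T2Space M] (g : RiemMetric m M)
    (hu : ContMDiff (𝓡 m) 𝓘(ℝ, ℝ) ∞ u) : ∫ p, laplacian g u p ∂(riemannianVolume g) = 0 := by
  have := isFiniteMeasure_riemannianVolume g
  obtain ⟨s, ρ, hρ, hsupp, hsum⟩ := exists_finset_sum_eq_one m M
  have hρu k : ContMDiff (𝓡 m) 𝓘(ℝ, ℝ) ∞ (fun p => ρ k p * u p) := (hρ k).mul hu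
  have hdecomp : u = fun p => ∑ k ∈ s, ρ k p * u p := by
    ext p
    rw [← Finset.sum_mul, hsum, one_mul]
  rw [hdecomp]
  simp only [laplacian_sum g s hρu]
  rw [integral_finsetSum _ fun k _ => (contMDiff_laplacian g (hρu k)).continuous
    |>.integrable_of_hasCompactSupport (HasCompactSupport.of_compactSpace _)]
  exact Finset.sum_eq_zero fun k _ => integral_laplacian_eq_zero_of_tsupport_subset
    (IsManifold.chart_mem_maximalAtlas k) (hρu k)
    ((closure_mono (Function.support_mul_subset_left _ _)).trans (hsupp k))

end

/-! ### Ricci-harmonic solitons -/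

section

variable {m n : ℕ} {M : Type*} [TopologicalSpace M] [ChartedSpace (Coord m) M]
  [IsManifold (𝓡 m) ∞ M] {N : Type*} [TopologicalSpace N] [ChartedSpace (Coord n) N]
  [IsManifold (𝓡 n) ∞ N] {g : RiemMetric m M} {h : RiemMetric n N} {φ : M → N} {f : M → ℝ}
  {α lam : ℝ} {p : M}

/-- The function `S + |∇f|² - 2λf` on a soliton, with `S` expressed as `mλ - Δf`; by Hamilton's
identity it is locally constant. -/
noncomputable def hamiltonInvariant (g : RiemMetric m M) (f : M → ℝ) (lam : ℝ) (p : M) : ℝ :=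
  m * lam - laplacian g f p + gradNormSq g f p - 2 * lam * f p

theorem contMDiff_hamiltonInvariant (g : RiemMetric m M) (hf : ContMDiff (𝓡 m) 𝓘(ℝ, ℝ) ∞ f)
    (lam : ℝ) : ContMDiff (𝓡 m) 𝓘(ℝ, ℝ) ∞ (hamiltonInvariant g f lam) :=
  ((contMDiff_const.sub (contMDiff_laplacian g hf)).add (contMDiff_gradNormSq g hf)).sub
    (contMDiff_const.mul hf)

theorem pd_hamiltonInvariant {e : OpenPartialHomeomorph M (Coord m)}
    (he : e ∈ IsManifold.maximalAtlas (𝓡 m) ∞ M) (g : RiemMetric m M)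
    (hf : ContMDiff (𝓡 m) 𝓘(ℝ, ℝ) ∞ f) (lam : ℝ) {z : Coord m} (hz : z ∈ e.target) (j : Fin m) :
    pd j (fun x => hamiltonInvariant g f lam (e.symm x)) z
      = pd j (gradInner (gram g e) (fun x => f (e.symm x)) fun x => f (e.symm x)) z
        - 2 * lam * pd j (fun x => f (e.symm x)) z
        - pd j (coordLaplacian (gram g e) fun x => f (e.symm x)) z := by
  have hG := isMetricOn_gram he g
  have hs := contDiffOn_comp_symm he hf
  have heq : Set.EqOn (fun x => hamiltonInvariant g f lam (e.symm x))
      (fun x => m * lam - coordLaplacian (gram g e) (fun x => f (e.symm x)) x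
        + gradInner (gram g e) (fun x => f (e.symm x)) (fun x => f (e.symm x)) x
        - 2 * lam * f (e.symm x)) e.target := fun x hx => by
    simp only [hamiltonInvariant, laplacian_symm_eq g he hf hx, gradNormSq_symm_eq g he hf hx]
  have dL := differentiableAt_of_contDiffOn hG.isOpen (hG.contDiffOn_coordLaplacian hs) hz
  have dA := differentiableAt_of_contDiffOn hG.isOpen (hG.contDiffOn_gradInner hs hs) hz
  have df := differentiableAt_of_contDiffOn hG.isOpen hs hz
  rw [pd_congr_of_eqOn e.open_target heq hz, pd_sub ((dL.const_sub _).fun_add dA) (df.const_mul _),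
    pd_add (dL.const_sub _) dA, pd_const_sub, pd_const_mul df]
  ring

namespace IsRicciHarmonicSoliton

theorem genScalarCurvature_eq (hsol : IsRicciHarmonicSoliton g h φ f α lam) (p : M) :
    genScalarCurvature g h φ α p = m * lam - laplacian g f p := by
  have he := IsManifold.chart_mem_maximalAtlas (I := 𝓡 m) (n := ∞) p
  have hy := mem_chart_target (Coord m) p
  have htrace := metricTrace_self (posDef_gram he g hy)
  have hs := hsol.soliton _ he _ hy
  rw [mul_comm (m : ℝ), ← htrace, eq_sub_iff_add_eq]
  simp only [genScalarCurvature, scalarCurvature, mapNormSq, laplacian, coordLaplacian,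
    metricTrace, Finset.mul_sum, ← Finset.sum_sub_distrib, ← Finset.sum_add_distrib]
  refine Finset.sum_congr rfl fun i _ => Finset.sum_congr rfl fun j _ => ?_
  rw [mul_left_comm lam, ← hs i j]
  ring

theorem exists_normal_charts (hsol : IsRicciHarmonicSoliton g h φ f α lam)
    (hφ : ContMDiff (𝓡 m) (𝓡 n) ∞ φ) (hf : ContMDiff (𝓡 m) 𝓘(ℝ, ℝ) ∞ f) (p : M) :
    ∃ e ∈ IsManifold.maximalAtlas (𝓡 m) ∞ M, ∃ e' ∈ IsManifold.maximalAtlas (𝓡 n) ∞ N,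
      p ∈ e.source ∧
      IsNormalAt (gram g e) (e.target ∩ (fun z => φ (e.symm z)) ⁻¹' e'.source) (e p) ∧
      IsNormalAt (gram h e') e'.target (e' (φ (e.symm (e p)))) ∧
      IsCoordSoliton (gram g e) (gram h e') (fun z => e' (φ (e.symm z)))
        (fun z => f (e.symm z)) α lam (e.target ∩ (fun z => φ (e.symm z)) ⁻¹' e'.source)
        e'.target := by
  obtain ⟨e, he, hp, hn⟩ := exists_normal_chart g p
  obtain ⟨e', he', hp', hn'⟩ := exists_normal_chart h (φ p)
  have hU := isOpen_chart_map e e' hφ.continuous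
  refine ⟨e, he, e', he', hp, ⟨hn.metric.mono hU Set.inter_subset_left, ⟨hn.mem, ?_⟩, hn.eq_one,
    hn.pd_eq_zero⟩, by rwa [e.left_inv hp], contDiffOn_chart_map he he' hφ,
    fun z hz => e'.map_source hz.2, (contDiffOn_comp_symm he hf).mono Set.inter_subset_left,
    fun z hz i j => ?_, fun z hz a => hsol.map_eq e he e' he' z hz.1 hz.2 a⟩
  · rwa [Set.mem_preimage, e.left_inv hp]
  · rw [← pullback_eq_coordPullback he he' h hφ hz]
    exact hsol.soliton e he z hz.1 i j

theorem isLocallyConstant_hamiltonInvariant (hsol : IsRicciHarmonicSoliton g h φ f α lam)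
    (hφ : ContMDiff (𝓡 m) (𝓡 n) ∞ φ) (hf : ContMDiff (𝓡 m) 𝓘(ℝ, ℝ) ∞ f) :
    IsLocallyConstant (hamiltonInvariant g f lam) := by
  have hI := contMDiff_hamiltonInvariant g hf lam
  refine isLocallyConstant_of_gradNormSq_eq_zero g hI fun p => ?_
  obtain ⟨e, he, e', -, hp, hG, hH, hs⟩ := hsol.exists_normal_charts hφ hf p
  have hpd j : pd j (fun x => hamiltonInvariant g f lam (e.symm x)) (e p) = 0 := by
    rw [pd_hamiltonInvariant he g hf lam hG.mem.1, hs.pd_coordLaplacian_eq hG hH, sub_self]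
  simp [gradNormSq_eq g he hI hp, hG.gradInner_apply, hpd]

theorem laplacian_le_of_isLocalMax (hsol : IsRicciHarmonicSoliton g h φ f α lam)
    (hφ : ContMDiff (𝓡 m) (𝓡 n) ∞ φ) (hf : ContMDiff (𝓡 m) 𝓘(ℝ, ℝ) ∞ f) (hlam : 0 < lam)
    (hmax : IsLocalMax (laplacian g f) p) : laplacian g f p ≤ m * lam := by
  obtain ⟨e, he, e', -, hp, hG, hH, hs⟩ := hsol.exists_normal_charts hφ hf p
  have hmax' : IsLocalMax (coordLaplacian (gram g e) fun z => f (e.symm z)) (e p) := by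
    refine (isLocalMax_comp_symm hp hmax).congr ?_
    filter_upwards [hG.metric.isOpen.mem_nhds hG.mem] with z hz
    exact laplacian_symm_eq g he hf hz.1
  rw [laplacian_eq g he hf hp]
  refine hs.coordLaplacian_le hG hH hsol.coupling_nonneg hlam (fun z hz j => ?_) (fun j => ?_)
    fun i => pd_pd_nonpos_of_isLocalMax hG.metric.isOpen
      (hG.metric.contDiffOn_coordLaplacian hs.contDiffOn_potential) hG.mem hmax' i
  · have hconst := pd_eq_zero_of_isLocallyConstant
      (hsol.isLocallyConstant_hamiltonInvariant hφ hf) e hz.1 j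
    rw [pd_hamiltonInvariant he g hf lam hz.1] at hconst
    exact (sub_eq_zero.1 hconst).symm
  · rw [pd, hmax'.fderiv_eq_zero, zero_apply]

theorem laplacian_le [CompactSpace M] (hsol : IsRicciHarmonicSoliton g h φ f α lam)
    (hφ : ContMDiff (𝓡 m) (𝓡 n) ∞ φ) (hf : ContMDiff (𝓡 m) 𝓘(ℝ, ℝ) ∞ f) (hlam : 0 < lam)
    (p : M) : laplacian g f p ≤ m * lam := by
  obtain ⟨q, -, hq⟩ := isCompact_univ.exists_isMaxOn ⟨p, Set.mem_univ p⟩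
    (contMDiff_laplacian g hf).continuous.continuousOn
  exact (hq (Set.mem_univ p)).trans
    (hsol.laplacian_le_of_isLocalMax hφ hf hlam (hq.isLocalMax Filter.univ_mem))

theorem isHarmonicEinstein_of_isLocallyConstant (hsol : IsRicciHarmonicSoliton g h φ f α lam)
    (hf : IsLocallyConstant f) : IsHarmonicEinstein g h φ α lam where
  einstein e he y hy i j := by
    have hpd z (hz : z ∈ e.target) (k : Fin m) : pd k (fun z => f (e.symm z)) z = 0 :=
      pd_eq_zero_of_isLocallyConstant hf e hz k
    have hpdpd : pd i (pd j fun z => f (e.symm z)) y = 0 := by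
      rw [pd_congr_of_eqOn (v := fun _ => 0) e.open_target (fun z hz => hpd z hz j) hy, pd_const]
    have hhess : hess (gram g e) (fun z => f (e.symm z)) i j y = 0 := by
      simp [hess, hpdpd, hpd y hy]
    rw [← hsol.soliton e he y hy i j, hhess, add_zero]
  harmonic e he e' he' y hy hy' a := by
    rw [hsol.map_eq e he e' he' y hy hy' a]
    simp [gradInner, metricTrace, pd_eq_zero_of_isLocallyConstant hf e hy]

theorem laplacian_eq_zero (hsol : IsRicciHarmonicSoliton g h φ f α lam)
    (hE : IsHarmonicEinstein g h φ α lam) (p : M) : laplacian g f p = 0 := by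
  have he := IsManifold.chart_mem_maximalAtlas (I := 𝓡 m) (n := ∞) p
  have hy := mem_chart_target (Coord m) p
  have hhess i j : hess (gram g (chartAt (Coord m) p))
      (fun y => f ((chartAt (Coord m) p).symm y)) i j (chartAt (Coord m) p p) = 0 := by
    linarith [hsol.soliton _ he _ hy i j, hE.einstein _ he _ hy i j]
  simp [laplacian, coordLaplacian, metricTrace, hhess]

end IsRicciHarmonicSoliton

end

/-! ### The gap -/

theorem exists_isLocallyConstant_max {X : Type*} [TopologicalSpace X] [CompactSpace X]
    {f W : X → ℝ} (hW : IsLocallyConstant W) (hf : Continuous f) :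
    ∃ F : X → ℝ, IsLocallyConstant F ∧ (∀ p, f p ≤ F p) ∧
      ∀ p, ∃ q, W q = W p ∧ F q = F p ∧ f q = F p := by
  have hmax (c : ℝ) : ∃ b : ℝ, ∀ p, W p = c → f p ≤ b ∧ ∃ q, W q = c ∧ f q = b := by
    by_cases hne : (W ⁻¹' {c}).Nonempty
    · have hclosed : IsClosed (W ⁻¹' {c}) := isClosed_singleton.preimage hW.continuous
      obtain ⟨q, hq, hqmax⟩ := hclosed.isCompact.exists_isMaxOn hne hf.continuousOn
      exact ⟨f q, fun p hp => ⟨hqmax hp, q, hq, rfl⟩⟩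
    · exact ⟨0, fun p hp => (hne ⟨p, hp⟩).elim⟩
  choose b hb using hmax
  refine ⟨fun p => b (W p), hW.comp b, fun p => (hb _ p rfl).1, fun p => ?_⟩
  obtain ⟨q, hq, hfq⟩ := (hb _ p rfl).2
  exact ⟨q, hq, congrArg b hq, hfq⟩

theorem contMDiff_of_isLocallyConstant {m : ℕ} {M : Type*} [TopologicalSpace M]
    [ChartedSpace (Coord m) M] {u : M → ℝ} (hu : IsLocallyConstant u) :
    ContMDiff (𝓡 m) 𝓘(ℝ, ℝ) ∞ u :=
  fun p => contMDiffAt_const.congr_of_eventuallyEq (hu.eventually_eq p)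

section

variable {m n : ℕ} {M : Type*} [TopologicalSpace M] [ChartedSpace (Coord m) M]
  [IsManifold (𝓡 m) ∞ M] {N : Type*} [TopologicalSpace N] [ChartedSpace (Coord n) N]
  [IsManifold (𝓡 n) ∞ N] {g : RiemMetric m M} {h : RiemMetric n N} {φ : M → N} {f u : M → ℝ}
  {α lam c b : ℝ}

variable [CompactSpace M]

theorem eq_zero_of_mul_add_laplacian_eq_zero (hu : ContMDiff (𝓡 m) 𝓘(ℝ, ℝ) ∞ u)
    (hu0 : ∀ p, 0 ≤ u p) (hc : 0 < c) (h0 : ∀ p, u p * (c + laplacian g u p) = 0) (p : M) :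
    u p = 0 := by
  by_contra hp
  have hsupport : {q | u q ≠ 0} = {q | c + laplacian g u q ≤ 0} := by
    ext q
    refine ⟨fun hq => ((mul_eq_zero.1 (h0 q)).resolve_left hq).le, fun hq hq0 => ?_⟩
    have hmin : IsLocalMin u q := Filter.Eventually.of_forall fun r => hq0 ▸ hu0 r
    have hlap := laplacian_nonneg_of_isLocalMin g hu hmin
    exact (add_pos_of_pos_of_nonneg hc hlap).not_ge hq
  have hopen : IsOpen {q | u q ≠ 0} := isOpen_ne.preimage hu.continuous
  have hclosed : IsClosed {q | u q ≠ 0} := by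
    rw [hsupport]
    exact isClosed_le (continuous_const.add (contMDiff_laplacian g hu).continuous)
      continuous_const
  obtain ⟨q, hq, hmin⟩ := hclosed.isCompact.exists_isMinOn ⟨p, hp⟩ hu.continuous.continuousOn
  have hlap := laplacian_nonneg_of_isLocalMin g hu (hmin.isLocalMin (hopen.mem_nhds hq))
  have hle : c + laplacian g u q ≤ 0 := hsupport.subset hq
  linarith

/-- On each level set of Hamilton's invariant, `u = F - f` vanishes where `f` is maximal, and
there the invariant is `S - 2λF`. -/
theorem IsRicciHarmonicSoliton.exists_normalized_potential
    (hsol : IsRicciHarmonicSoliton g h φ f α lam)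
    (hφ : ContMDiff (𝓡 m) (𝓡 n) ∞ φ) (hf : ContMDiff (𝓡 m) 𝓘(ℝ, ℝ) ∞ f)
    (hb : ∀ p, m * lam - laplacian g f p ≤ b) :
    ∃ F : M → ℝ, IsLocallyConstant F ∧ (∀ p, f p ≤ F p) ∧
      ∀ p, m * lam - laplacian g f p + gradNormSq g f p + 2 * lam * (F p - f p) ≤ b := by
  have hI := hsol.isLocallyConstant_hamiltonInvariant hφ hf
  obtain ⟨F, hF, hfF, hex⟩ := exists_isLocallyConstant_max hI hf.continuous
  refine ⟨F, hF, hfF, fun p => ?_⟩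
  obtain ⟨q, hIq, hFq, hfq⟩ := hex p
  have hmax : IsLocalMax f q := by
    filter_upwards [hF.eventually_eq q] with r hr
    rw [hfq, ← hFq, ← hr]
    exact hfF r
  have hgrad := gradNormSq_eq_zero_of_isLocalMax g hmax
  simp only [hamiltonInvariant, hgrad, hfq] at hIq
  linarith [hb q]

variable [MeasurableSpace M] [BorelSpace M]

theorem integrable_of_continuous (g : RiemMetric m M) (hu : Continuous u) :
    Integrable u (riemannianVolume g) :=
  have := isFiniteMeasure_riemannianVolume g
  hu.integrable_of_hasCompactSupport (HasCompactSupport.of_compactSpace _)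

theorem mul_eq_zero_of_integral_mul_nonpos {v : M → ℝ} (hu : Continuous u) (hv : Continuous v)
    (hu0 : ∀ p, 0 ≤ u p) (hv0 : ∀ p, 0 ≤ v p)
    (hle : ∫ p, u p * v p ∂(riemannianVolume g) ≤ 0) (p : M) : u p * v p = 0 := by
  have := isOpenPosMeasure_riemannianVolume g
  have hnonneg p : 0 ≤ u p * v p := mul_nonneg (hu0 p) (hv0 p)
  have hae := (integral_eq_zero_iff_of_nonneg hnonneg
    (integrable_of_continuous g (hu.mul hv))).1 (le_antisymm hle (integral_nonneg hnonneg))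
  exact congrFun (((hu.mul hv).ae_eq_iff_eq _ continuous_const).1 hae) p

theorem real_riemannianVolume_univ_pos [Nonempty M] (g : RiemMetric m M) :
    0 < (riemannianVolume g).real Set.univ := by
  have := isFiniteMeasure_riemannianVolume g
  have := isOpenPosMeasure_riemannianVolume g
  exact ENNReal.toReal_pos (isOpen_univ.measure_ne_zero _ Set.univ_nonempty) (measure_ne_top _ _)

variable [T2Space M]

theorem integral_mul_laplacian_self (g : RiemMetric m M) (hu : ContMDiff (𝓡 m) 𝓘(ℝ, ℝ) ∞ u) :
    ∫ p, u p * laplacian g u p ∂(riemannianVolume g)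
      = -∫ p, gradNormSq g u p ∂(riemannianVolume g) := by
  have hgreen : ∫ p, laplacian g (fun q => u q * u q) p ∂(riemannianVolume g) = 0 :=
    integral_laplacian_eq_zero g (hu.mul hu)
  simp only [laplacian_mul_self g hu] at hgreen
  have hint : Integrable (fun p => u p * laplacian g u p) (riemannianVolume g) :=
    integrable_of_continuous g (hu.continuous.mul (contMDiff_laplacian g hu).continuous)
  rw [integral_const_mul, integral_add hint
    (integrable_of_continuous g (contMDiff_gradNormSq g hu).continuous)] at hgreen
  linarith

theorem integral_mul_add_laplacian (g : RiemMetric m M) (hu : ContMDiff (𝓡 m) 𝓘(ℝ, ℝ) ∞ u)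
    (c : ℝ) :
    ∫ p, u p * (c + laplacian g u p) ∂(riemannianVolume g)
      = c * ∫ p, u p ∂(riemannianVolume g) - ∫ p, gradNormSq g u p ∂(riemannianVolume g) := by
  have hint : Integrable (fun p => u p * laplacian g u p) (riemannianVolume g) :=
    integrable_of_continuous g (hu.continuous.mul (contMDiff_laplacian g hu).continuous)
  simp only [mul_add]
  rw [integral_add ((integrable_of_continuous g hu.continuous).mul_const c) hint,
    integral_mul_laplacian_self g hu, integral_mul_const, mul_comm c, sub_eq_add_neg]

theorem integral_le_of_forall_le (hu : ContMDiff (𝓡 m) 𝓘(ℝ, ℝ) ∞ u)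
    (hb : ∀ p, c + laplacian g u p + gradNormSq g u p + 2 * lam * u p ≤ b) :
    ∫ p, gradNormSq g u p ∂(riemannianVolume g) + 2 * lam * ∫ p, u p ∂(riemannianVolume g)
      ≤ (b - c) * (riemannianVolume g).real Set.univ := by
  have := isFiniteMeasure_riemannianVolume g
  have iL := integrable_of_continuous g (contMDiff_laplacian g hu).continuous
  have iA := integrable_of_continuous g (contMDiff_gradNormSq g hu).continuous
  have iu := (integrable_of_continuous g hu.continuous).const_mul (2 * lam)
  have hint := integral_mono ((iL.add iA).add iu) (integrable_const (b - c)) fun p => by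
    simp only [Pi.add_apply]
    linarith [hb p]
  rwa [integral_add' (iL.add iA) iu, integral_add' iL iA, integral_laplacian_eq_zero g hu,
    zero_add, integral_const_mul, integral_const, smul_eq_mul, mul_comm _ (b - c)] at hint

theorem integral_mul_add_laplacian_nonpos [Nonempty M] (hm : 0 < m)
    (hu : ContMDiff (𝓡 m) 𝓘(ℝ, ℝ) ∞ u)
    (hb : ∀ p, m * lam + laplacian g u p + gradNormSq g u p + 2 * lam * u p ≤ b)
    (hle : b - m * lam ≤ (1 + 2 / (m : ℝ)) * (1 / (riemannianVolume g).real Set.univ *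
      ∫ p, gradNormSq g u p ∂(riemannianVolume g))) :
    ∫ p, u p * (m * lam + laplacian g u p) ∂(riemannianVolume g) ≤ 0 := by
  have hV := real_riemannianVolume_univ_pos g
  have hm' : (0 : ℝ) < m := by exact_mod_cast hm
  rw [integral_mul_add_laplacian g hu]
  have hint := integral_le_of_forall_le hu hb
  set A := ∫ p, gradNormSq g u p ∂(riemannianVolume g)
  set V := (riemannianVolume g).real Set.univ
  have hgap : (b - m * lam) * V ≤ (1 + 2 / (m : ℝ)) * A := by
    refine (mul_le_mul_of_nonneg_right hle hV.le).trans_eq ?_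
    field_simp
  have hmean : 2 * lam * ∫ p, u p ∂(riemannianVolume g) ≤ 2 / (m : ℝ) * A := by linarith
  have hmul := mul_le_mul_of_nonneg_left hmean hm'.le
  have hcancel : (m : ℝ) * (2 / (m : ℝ) * A) = 2 * A := by field_simp
  linarith

theorem IsRicciHarmonicSoliton.isLocallyConstant_of_le [Nonempty M] (hm : 0 < m)
    (hsol : IsRicciHarmonicSoliton g h φ f α lam) (hφ : ContMDiff (𝓡 m) (𝓡 n) ∞ φ)
    (hf : ContMDiff (𝓡 m) 𝓘(ℝ, ℝ) ∞ f) (hlam : 0 < lam)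
    (hb : ∀ p, m * lam - laplacian g f p ≤ b)
    (hle : b - m * lam ≤ (1 + 2 / (m : ℝ)) * (1 / (riemannianVolume g).real Set.univ *
      ∫ p, gradNormSq g f p ∂(riemannianVolume g))) : IsLocallyConstant f := by
  obtain ⟨F, hF, hfF, hptw⟩ := hsol.exists_normalized_potential hφ hf hb
  let u : M → ℝ := fun q => F q - f q
  have hu : ContMDiff (𝓡 m) 𝓘(ℝ, ℝ) ∞ u := (contMDiff_of_isLocallyConstant hF).sub hf
  have hu0 p : 0 ≤ u p := sub_nonneg.2 (hfF p)
  have hlap p : laplacian g u p = -laplacian g f p := laplacian_sub_of_isLocallyConstant g hF f p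
  have hgrad p : gradNormSq g u p = gradNormSq g f p :=
    gradNormSq_sub_of_isLocallyConstant g hF f p
  have hS p : 0 ≤ m * lam + laplacian g u p := by
    linarith [hlap p, hsol.laplacian_le hφ hf hlam p]
  have hint : ∫ p, u p * (m * lam + laplacian g u p) ∂(riemannianVolume g) ≤ 0 :=
    integral_mul_add_laplacian_nonpos hm hu
      (fun p => by rw [hlap, hgrad, ← sub_eq_add_neg]; exact hptw p) (by simpa only [hgrad])
  have hmul := mul_eq_zero_of_integral_mul_nonpos hu.continuous
    (continuous_const.add (contMDiff_laplacian g hu).continuous) hu0 hS hint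
  have hu_zero := eq_zero_of_mul_add_laplacian_eq_zero hu hu0 (by positivity) hmul
  have hFf : F = f := funext fun p => sub_eq_zero.1 (hu_zero p)
  exact hFf ▸ hF

end

end RicciHarmonic

theorem theorem3p1 {m n : ℕ} (hm : 0 < m)
    {M : Type*} [TopologicalSpace M] [ChartedSpace (RicciHarmonic.Coord m) M]
    [IsManifold (𝓡 m) ∞ M] [T2Space M] [CompactSpace M] [Nonempty M]
    [MeasurableSpace M] [BorelSpace M]
    {N : Type*} [TopologicalSpace N] [ChartedSpace (RicciHarmonic.Coord n) N]
    [IsManifold (𝓡 n) ∞ N]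
    (g : RicciHarmonic.RiemMetric m M) (h : RicciHarmonic.RiemMetric n N)
    (φ : M → N) (hφ : ContMDiff (𝓡 m) (𝓡 n) ∞ φ)
    (f : M → ℝ) (hf : ContMDiff (𝓡 m) 𝓘(ℝ, ℝ) ∞ f)
    (α lam : ℝ) (hsol : RicciHarmonic.IsRicciHarmonicSoliton g h φ f α lam) (hlam : 0 < lam) :
    ∃ Smax : ℝ, IsGreatest (Set.range (RicciHarmonic.genScalarCurvature g h φ α)) Smax ∧
      (RicciHarmonic.IsHarmonicEinstein g h φ α lam ↔
        Smax - m * lam ≤ (1 + 2 / (m : ℝ)) *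
          (1 / (RicciHarmonic.riemannianVolume g).real Set.univ *
            ∫ p, RicciHarmonic.gradNormSq g f p ∂(RicciHarmonic.riemannianVolume g))) := by
  have hS := hsol.genScalarCurvature_eq
  have hcont : Continuous (RicciHarmonic.genScalarCurvature g h φ α) := by
    rw [funext hS]
    exact continuous_const.sub (RicciHarmonic.contMDiff_laplacian g hf).continuous
  obtain ⟨Smax, hmax⟩ := (isCompact_range hcont).exists_isGreatest (Set.range_nonempty _)
  refine ⟨Smax, hmax, fun hE => ?_, fun hle => ?_⟩
  · obtain ⟨p, hp⟩ := hmax.1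
    rw [← hp, hS, hsol.laplacian_eq_zero hE, sub_zero, sub_self]
    have hgrad : 0 ≤ ∫ p, RicciHarmonic.gradNormSq g f p ∂(RicciHarmonic.riemannianVolume g) :=
      integral_nonneg (RicciHarmonic.gradNormSq_nonneg g f)
    positivity
  · exact hsol.isHarmonicEinstein_of_isLocallyConstant <| hsol.isLocallyConstant_of_le hm hφ hf
      hlam (fun p => hS p ▸ hmax.2 ⟨p, rfl⟩) hle
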